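/- Let $n$ and $d$ be positive integers, let $\lambda$ be a partition of $n$ with parts $\lambda_1 \ge \lambda_2 \ge \dots$ (where $\lambda_i = 0$ for $i$ larger than the number of parts), let $K$ be a field of characteristic $2$ (finite or infinite), and let $E = K^d$ be the natural representation of $\mathrm{GL}_d(K)$. For a representation $V$ of a group $G$ with basis $\mathcal B$, let $\mathrm{Sym}^\lambda V$ be the quotient of the $\lambda$-shaped tensor power $V^{\otimes n}$ (tensor positions indexed by the boxes of the Young diagram of $\lambda$) by the span of all $x\cdot\sigma - x$ with $\sigma$ a row-preserving permutation of the boxes. For a tableau $t$ of shape $\lambda$ with entries in $\mathcal B$, regarded as a pure tensor, its polytabloid is $e(t) = \sum_{\sigma} \mathrm{sign}(\sigma)\,[t\cdot\sigma] \in \mathrm{Sym}^\lambda V$, the sum being over all column-preserving permutations $\sigma$ of the boxes. The subrepresentation of $\mathrm{Sym}^\lambda V$ spanned by all polytabloids is $\nabla^\lambda(V)$; the dual Weyl module is $\nabla^\lambda(E)$. The Specht module $S^\lambda$ is the $KS_n$-submodule of $\nabla^\lambda(W)$ spanned by the $e(t)$ for tableaux $t$ with pairwise distinct entries, where $W = K^n$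 is the natural permutation module of $S_n$ with its permutation basis. For a left $KS_n$-module $U$, put $\mathcal G_\otimes(U) = E^{\otimes n} \otimes_{KS_n} U$, a representation of $\mathrm{GL}_d(K)$, where $S_n$ acts on $E^{\otimes n}$ on the right by place permutation. A partition is $2$-regular if it has no repeated positive parts. Consider the condition $(\ast)$ $\lambda$ is $2$-regular, or $\lambda_1 = \lambda_2 \ge \lambda_3 + 2$ and the partition $(\lambda_2, \lambda_3, \dots)$ is $2$-regular. Then there is a surjective homomorphism $\mathcal G_\otimes(S^\lambda) \twoheadrightarrow \nabla^\lambda(E)$ of $K\mathrm{GL}_d(K)$-modules which is an isomorphism if $(\ast)$ holds, and which is not an isomorphism if $(\ast)$ fails and $d \ge n-2$. -/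

import Mathlib

open scoped TensorProduct

noncomputable section

namespace SchurFunctor

/-! ### Tensor powers: group action and place permutation -/

section TensorPowers

variable {K : Type*} [Field K] {G : Type*} [Group G] {V : Type*} [AddCommGroup V] [Module K V]
  (ι : Type*)

/-- The diagonal action of `G` on the tensor power `V^{⊗ ι}`. -/
def tensorRep (ρ : Representation K G V) : Representation K G (⨂[K] _ : ι, V) where
  toFun g := PiTensorProduct.map fun _ => ρ g
  map_one' := by
    ext x
    simp
  map_mul' g h := by
    ext x
    simp

variable {ι} in
/-- The right place permutation action of `Perm ι` on `V^{⊗ ι}`: the factor of `x · σ` in place `i`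
is the factor of `x` in place `σ i`. -/
def placePerm (σ : Equiv.Perm ι) : (⨂[K] _ : ι, V) →ₗ[K] (⨂[K] _ : ι, V) :=
  (PiTensorProduct.reindex K (fun _ : ι => V) σ.symm).toLinearMap

variable {ι} in
theorem placePerm_tprod (σ : Equiv.Perm ι) (v : ι → V) :
    placePerm σ (PiTensorProduct.tprod K v) = PiTensorProduct.tprod K fun i => v (σ i) := by
  simp [placePerm]

variable {ι} in
theorem tensorRep_placePerm (ρ : Representation K G V) (g : G) (σ : Equiv.Perm ι)
    (x : ⨂[K] _ : ι, V) :
    tensorRep ι ρ g (placePerm σ x) = placePerm σ (tensorRep ι ρ g x) := by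
  have h : tensorRep ι ρ g ∘ₗ placePerm σ = placePerm σ ∘ₗ tensorRep ι ρ g := by
    ext v
    simp [tensorRep, placePerm_tprod]
  exact LinearMap.congr_fun h x

end TensorPowers

/-! ### The inverse Schur functor -/

section InverseSchur

variable {K : Type*} [Field K]

/-- The natural representation `E = K^d` of `GL_d(K)`. -/
def natRep (K : Type*) [Field K] (d : ℕ) :
    Representation K (Matrix.GeneralLinearGroup (Fin d) K) (Fin d → K) where
  toFun g := Matrix.mulVecLin (g : Matrix (Fin d) (Fin d) K)
  map_one' := by
    ext
    simp
  map_mul' g h := by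
    simp [Matrix.mulVecLin_mul, Module.End.mul_eq_comp]

variable {G : Type*} [Group G] {V : Type*} [AddCommGroup V] [Module K V]
  {n : ℕ} {U : Type*} [AddCommGroup U] [Module K U]

variable (V) in
/-- The relations `(x · σ) ⊗ u = x ⊗ (σ u)`, for `σ` in the symmetric group `S_n`, which present
`V^{⊗ n} ⊗_{K S_n} U` as a quotient of `V^{⊗ n} ⊗_K U`. -/
def balancedRel (τ : Representation K (Equiv.Perm (Fin n)) U) :
    Submodule K ((⨂[K] _ : Fin n, V) ⊗[K] U) :=
  Submodule.span K {z | ∃ (σ : Equiv.Perm (Fin n)) (x : ⨂[K] _ : Fin n, V) (u : U),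
    z = placePerm σ x ⊗ₜ[K] u - x ⊗ₜ[K] τ σ u}

variable (V) in
/-- The space `V^{⊗ n} ⊗_{K S_n} U`, where `S_n` acts on the right of `V^{⊗ n}` by place
permutation. -/
abbrev BalancedTensor (τ : Representation K (Equiv.Perm (Fin n)) U) : Type _ :=
  ((⨂[K] _ : Fin n, V) ⊗[K] U) ⧸ balancedRel V τ

variable (n U) in
/-- The action of `G` on `V^{⊗ n} ⊗_K U` through the first factor. -/
def firstFactorRep (ρ : Representation K G V) :
    Representation K G ((⨂[K] _ : Fin n, V) ⊗[K] U) :=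
  (tensorRep (Fin n) ρ).tprod (Representation.trivial K G U)

theorem balancedRel_stable (ρ : Representation K G V)
    (τ : Representation K (Equiv.Perm (Fin n)) U) (g : G) :
    balancedRel V τ ≤ (balancedRel V τ).comap (firstFactorRep n U ρ g) := by
  refine Submodule.span_le.2 ?_
  rintro _ ⟨σ, x, u, rfl⟩
  refine Submodule.subset_span ⟨σ, tensorRep (Fin n) ρ g x, u, ?_⟩
  simp [firstFactorRep, tensorRep_placePerm]

/-- The representation `V^{⊗ n} ⊗_{K S_n} U` of `G`. -/
def balancedTensorRep (ρ : Representation K G V) (τ : Representation K (Equiv.Perm (Fin n)) U) :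
    Representation K G (BalancedTensor V τ) :=
  (firstFactorRep n U ρ).quotient (balancedRel V τ) (balancedRel_stable ρ τ)

/-- The inverse Schur functor: the representation `G_⊗(U) = E^{⊗ n} ⊗_{K S_n} U` of `GL_d(K)`. -/
def inverseSchur (d : ℕ) (τ : Representation K (Equiv.Perm (Fin n)) U) :
    Representation K (Matrix.GeneralLinearGroup (Fin d) K) (BalancedTensor (Fin d → K) τ) :=
  balancedTensorRep (natRep K d) τ

end InverseSchur

/-! ### Tabloids and polytabloids of shape `μ` -/

section Polytabloids

/-- The boxes of a Young diagram, `(i, j)` being the box in row `i` and column `j`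
(both counted from `0`). -/
abbrev Box (μ : YoungDiagram) : Type := {c : ℕ × ℕ // c ∈ μ.cells}

/-- Place permutations which preserve every row. -/
def IsRowPreserving {μ : YoungDiagram} (σ : Equiv.Perm (Box μ)) : Prop :=
  ∀ c : Box μ, (σ c).1.1 = c.1.1

/-- Place permutations which preserve every column. -/
def IsColPreserving {μ : YoungDiagram} (σ : Equiv.Perm (Box μ)) : Prop :=
  ∀ c : Box μ, (σ c).1.2 = c.1.2

instance {μ : YoungDiagram} : DecidablePred (IsColPreserving (μ := μ)) := fun σ =>
  inferInstanceAs (Decidable (∀ c : Box μ, (σ c).1.2 = c.1.2))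

variable {K : Type*} [Field K] {G : Type*} [Group G] {V : Type*} [AddCommGroup V] [Module K V]
  (μ : YoungDiagram)

variable (K V) in
/-- The span of the elements `x · σ - x` with `σ` row-preserving. -/
def symRel : Submodule K (⨂[K] _ : Box μ, V) :=
  Submodule.span K {z | ∃ (x : ⨂[K] _ : Box μ, V) (σ : Equiv.Perm (Box μ)),
    IsRowPreserving σ ∧ z = placePerm σ x - x}

variable (K V) in
/-- The space `Sym^μ V` of row tabloids. -/
abbrev RowTabloids : Type _ := (⨂[K] _ : Box μ, V) ⧸ symRel K V μ

theorem symRel_stable (ρ : Representation K G V) (g : G) :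
    symRel K V μ ≤ (symRel K V μ).comap (tensorRep (Box μ) ρ g) := by
  refine Submodule.span_le.2 ?_
  rintro _ ⟨x, σ, hσ, rfl⟩
  refine Submodule.subset_span ⟨tensorRep (Box μ) ρ g x, σ, hσ, ?_⟩
  simp [tensorRep_placePerm]

/-- The action of `G` on the space of row tabloids. -/
def rowTabloidRep (ρ : Representation K G V) : Representation K G (RowTabloids K V μ) :=
  (tensorRep (Box μ) ρ).quotient (symRel K V μ) (symRel_stable μ ρ)

variable {μ} in
/-- The element of `V^{⊗ μ}` given by a tableau with entries in (the index set of) a basis. -/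
def tableauTensor {B : Type*} (b : Module.Basis B K V) (t : Box μ → B) : ⨂[K] _ : Box μ, V :=
  PiTensorProduct.tprod K fun c => b (t c)

variable (K V) in
/-- The linear map `x ↦ ∑ sign(σ) {x · σ}`, the sum being over the column-preserving place
permutations `σ` and `{y}` denoting the class of `y` in `Sym^μ V`. -/
def colAntisymmetriser : (⨂[K] _ : Box μ, V) →ₗ[K] RowTabloids K V μ :=
  ∑ σ : Equiv.Perm (Box μ) with IsColPreserving σ,
    ((Equiv.Perm.sign σ : ℤ) : K) • ((symRel K V μ).mkQ ∘ₗ placePerm σ)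

theorem rowTabloidRep_colAntisymmetriser (ρ : Representation K G V) (g : G)
    (x : ⨂[K] _ : Box μ, V) :
    rowTabloidRep μ ρ g (colAntisymmetriser K V μ x) =
      colAntisymmetriser K V μ (tensorRep (Box μ) ρ g x) := by
  simp only [colAntisymmetriser, LinearMap.sum_apply, map_sum, LinearMap.smul_apply, map_smul,
    LinearMap.comp_apply, Submodule.mkQ_apply, ← tensorRep_placePerm]
  rfl

variable {μ} in
/-- The polytabloid `e(t)` of a tableau `t`. -/
def polytabloid {B : Type*} (b : Module.Basis B K V) (t : Box μ → B) : RowTabloids K V μ :=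
  colAntisymmetriser K V μ (tableauTensor b t)

/-- The space `∇^μ(V)`: the span of all polytabloids of shape `μ`. -/
def nablaSubmodule {B : Type*} (b : Module.Basis B K V) : Submodule K (RowTabloids K V μ) :=
  Submodule.span K (Set.range fun t : Box μ → B => polytabloid b t)

theorem nablaSubmodule_eq_range {B : Type*} (b : Module.Basis B K V) :
    nablaSubmodule μ b = LinearMap.range (colAntisymmetriser K V μ) := by
  have h : Submodule.span K (Set.range fun t : Box μ → B => tableauTensor b t) = ⊤ := by
    rw [← (Basis.piTensorProduct fun _ : Box μ => b).span_eq]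
    congr 2
    funext t
    simp [tableauTensor]
  rw [LinearMap.range_eq_map, ← h, Submodule.map_span, ← Set.range_comp]
  rfl

/-- `∇^μ(V)` as a subrepresentation of `Sym^μ V`. -/
def nabla (ρ : Representation K G V) {B : Type*} (b : Module.Basis B K V) :
    Subrepresentation (rowTabloidRep μ ρ) where
  toSubmodule := nablaSubmodule μ b
  apply_mem_toSubmodule g v hv := by
    rw [nablaSubmodule_eq_range] at hv ⊢
    obtain ⟨x, rfl⟩ := hv
    exact ⟨_, (rowTabloidRep_colAntisymmetriser μ ρ g x).symm⟩

end Polytabloids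

/-! ### Dual Weyl modules and Specht modules -/

section Modules

variable (K : Type*) [Field K] (μ : YoungDiagram)

/-- The dual Weyl module `∇^μ(E)` for `GL_d(K)`. -/
def dualWeyl (d : ℕ) : Subrepresentation (rowTabloidRep μ (natRep K d)) :=
  nabla μ (natRep K d) (Pi.basisFun K (Fin d))

/-- The natural permutation module `W = K^n` of the symmetric group `S_n`, in which `σ` sends the
basis vector `e_i` to `e_{σ i}`. -/
def permRep (n : ℕ) : Representation K (Equiv.Perm (Fin n)) (Fin n → K) where
  toFun σ := LinearMap.funLeft K K ⇑σ⁻¹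
  map_one' := rfl
  map_mul' _ _ := rfl

theorem permRep_basisFun (n : ℕ) (σ : Equiv.Perm (Fin n)) (i : Fin n) :
    permRep K n σ (Pi.basisFun K (Fin n) i) = Pi.basisFun K (Fin n) (σ i) := by
  ext j
  have h : (σ⁻¹ j = i) ↔ (j = σ i) := Equiv.Perm.inv_eq_iff_eq
  change (Pi.basisFun K (Fin n) i) (σ⁻¹ j) = _
  simp only [Pi.basisFun_apply, Pi.single_apply, h]

/-- The Specht module `S^μ` for `S_n`, where `n` is the size of `μ`: the span in `Sym^μ W` of the
polytabloids of the tableaux with pairwise distinct entries in `{1, …, n}`. -/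
def specht : Subrepresentation (rowTabloidRep μ (permRep K μ.card)) where
  toSubmodule := Submodule.span K {z | ∃ t : Box μ → Fin μ.card, Function.Injective t ∧
    z = polytabloid (Pi.basisFun K (Fin μ.card)) t}
  apply_mem_toSubmodule g v hv := by
    induction hv using Submodule.span_induction with
    | mem z hz =>
      obtain ⟨t, ht, rfl⟩ := hz
      refine Submodule.subset_span ⟨fun c => g (t c), g.injective.comp ht, ?_⟩
      rw [polytabloid, rowTabloidRep_colAntisymmetriser, polytabloid]
      congr 1
      simp only [tableauTensor, tensorRep, MonoidHom.coe_mk, OneHom.coe_mk,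
        PiTensorProduct.map_tprod, permRep_basisFun]
    | zero => simp
    | add x y _ _ hx hy =>
      rw [map_add]
      exact add_mem hx hy
    | smul a x _ hx =>
      rw [map_smul]
      exact Submodule.smul_mem _ a hx

/-- A partition is `2`-regular if it has no repeated positive parts. -/
def TwoRegular (parts : List ℕ) : Prop := parts.Nodup

/-- Either `μ` is `2`-regular, or `μ₁ = μ₂ ≥ μ₃ + 2` and `μ` minus its first part is `2`-regular.
Here `rowLens` is the list of positive parts in weakly decreasing order, and `rowLen i` is the part
with index `i` counted from `0`, being `0` if there is no such part. -/
def IsTwoRegularOrNearly : Prop :=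
  TwoRegular μ.rowLens ∨
    (μ.rowLen 0 = μ.rowLen 1 ∧ μ.rowLen 2 + 2 ≤ μ.rowLen 1 ∧ TwoRegular μ.rowLens.tail)

end Modules

end SchurFunctor

end

/-! Call a function on tableaux Garnir if it is invariant under column permutations and satisfies
the Garnir relations without signs (`IsGarnir`); it need not vanish on a tableau with a repeated
entry in a column. In characteristic two that vanishing does not follow from column invariance, and
the theorem is about when the Garnir relations force it.

The module `E^{⊗ n} ⊗ S^λ` carries the universal Garnir function on tableaux with entries in `{1, …,
d}` (`isGarnir_tableauClass`, `IsGarnir.exists_lift`). Polytabloids are a Garnir function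
(`isGarnir_polytabloid`), which gives the surjection. Straightening (`IsGarnir.mem_span`) reduces
every tableau to ones weakly increasing along rows and columns; those with distinct column entries
are semistandard, and their polytabloids are linearly independent. Hence the surjection is bijective
as soon as the universal function vanishes on repeated column entries.

Under (∗) this vanishing passes from column `j + 1` to column `j` whenever the column length drops
by at most one (`IsGarnir.alternatesOn_of_succ`). It starts at an empty column if `λ` is
`2`-regular, and otherwise at the last column, where a Garnir relation between two columns of length
two gives it directly.

If (∗) fails, three consecutive rows of equal entries give a tableau `s` whose polytabloid is zero.
The indicator function of the column rearrangements of `s` is Garnir, because the binomial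
coefficients counting the terms are even, so the class of `s` in `E^{⊗ n} ⊗ S^λ` is nonzero. -/

noncomputable section

namespace SchurFunctor

open Finset

/-! ### Coset representatives for the Garnir relations. -/

section BlockPermutations

variable {α : Type*}

/-- `σ` is supported on `X` and maps `A` onto `P`. -/
def IsBlockPerm (A X P : Finset α) (σ : Equiv.Perm α) : Prop :=
  (∀ b, b ∉ X → σ b = b) ∧ ∀ b, σ b ∈ P ↔ b ∈ A

theorem IsBlockPerm.mem_iff {A X P : Finset α} {σ : Equiv.Perm α} (h : IsBlockPerm A X P σ)
    (b : α) : σ b ∈ X ↔ b ∈ X := by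
  by_cases hb : b ∈ X
  · refine iff_of_true ?_ hb
    by_contra hc
    exact hc (by rwa [σ.injective (h.1 _ hc)])
  · rw [h.1 b hb]

theorem IsBlockPerm.symm_mem_iff {A X P : Finset α} {σ : Equiv.Perm α} (h : IsBlockPerm A X P σ)
    (b : α) : σ.symm b ∈ A ↔ b ∈ P := by
  simp [← h.2]

theorem IsBlockPerm.mul {A X P Q : Finset α} {σ ρ : Equiv.Perm α} (hρ : IsBlockPerm P X Q ρ)
    (hσ : IsBlockPerm A X P σ) : IsBlockPerm A X Q (ρ * σ) := by
  refine ⟨fun b hb => ?_, fun b => ?_⟩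
  · rw [Equiv.Perm.mul_apply, hσ.1 b hb, hρ.1 b hb]
  · rw [Equiv.Perm.mul_apply, hρ.2, hσ.2]

theorem IsBlockPerm.inv {A X P : Finset α} {σ : Equiv.Perm α} (h : IsBlockPerm A X P σ) :
    IsBlockPerm P X A σ⁻¹ := by
  refine ⟨fun b hb => ?_, fun b => ?_⟩
  · rw [Equiv.Perm.inv_eq_iff_eq, h.1 b hb]
  · rw [← h.2]
    simp

theorem exists_isBlockPerm [DecidableEq α] {A X P : Finset α} (hA : A ⊆ X) (hP : P ⊆ X)
    (h : P.card = A.card) :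
    ∃ σ, IsBlockPerm A X P σ := by
  have hcard : Fintype.card {x : X // x.1 ∈ A} = Fintype.card {x : X // x.1 ∈ P} := by
    have key : ∀ Q : Finset α, Q ⊆ X → Fintype.card {x : X // x.1 ∈ Q} = Q.card := by
      intro Q hQ
      rw [← Fintype.card_coe Q]
      exact Fintype.card_congr
        { toFun := fun x => ⟨x.1.1, x.2⟩
          invFun := fun x => ⟨⟨x.1, hQ x.2⟩, x.2⟩
          left_inv := fun _ => rfl
          right_inv := fun _ => rfl }
    rw [key A hA, key P hP, h]
  let e := Fintype.equivOfCardEq hcard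
  refine ⟨Equiv.Perm.ofSubtype e.extendSubtype, fun b hb => ?_, fun b => ?_⟩
  · exact Equiv.Perm.ofSubtype_apply_of_not_mem _ hb
  · by_cases hb : b ∈ X
    · rw [Equiv.Perm.ofSubtype_apply_of_mem _ hb]
      by_cases hbA : b ∈ A
      · exact iff_of_true (e.extendSubtype_mem ⟨b, hb⟩ hbA) hbA
      · exact iff_of_false (e.extendSubtype_not_mem ⟨b, hb⟩ hbA) hbA
    · rw [Equiv.Perm.ofSubtype_apply_of_not_mem _ hb]
      exact iff_of_false (fun hc => hb (hP hc)) (fun hc => hb (hA hc))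

open scoped Classical in
/-- A permutation which is supported on `X` and maps `A` onto `P`, if there is one. -/
def blockPerm [DecidableEq α] (A X P : Finset α) : Equiv.Perm α :=
  if h : ∃ σ, IsBlockPerm A X P σ then h.choose else 1

theorem isBlockPerm_blockPerm [DecidableEq α] {A X P : Finset α} (hA : A ⊆ X)
    (hP : P ∈ X.powersetCard A.card) : IsBlockPerm A X P (blockPerm A X P) := by
  have h := exists_isBlockPerm hA (mem_powersetCard.1 hP).1 (mem_powersetCard.1 hP).2
  rw [blockPerm, dif_pos h]
  exact h.choose_spec

theorem isBlockPerm_swap [DecidableEq α] {X P : Finset α} {x y : α} (hx : x ∈ X) (hy : y ∈ X) :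
    IsBlockPerm P X (P.map (Equiv.swap x y).toEmbedding) (Equiv.swap x y) := by
  refine ⟨fun b hb => ?_, fun b => ?_⟩
  · exact Equiv.swap_apply_of_ne_of_ne (fun h => hb (h ▸ hx)) (fun h => hb (h ▸ hy))
  · rw [Finset.mem_map_equiv, Equiv.symm_apply_apply]

theorem powersetCard_map_mem {X P : Finset α} {ρ : Equiv.Perm α} {m : ℕ}
    (hρ : ∀ b, ρ b ∈ X ↔ b ∈ X) (hP : P ∈ X.powersetCard m) :
    P.map ρ.toEmbedding ∈ X.powersetCard m := by
  rw [mem_powersetCard] at hP ⊢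
  refine ⟨fun b hb => ?_, by rw [card_map, hP.2]⟩
  rw [Finset.mem_map_equiv] at hb
  simpa using (hρ _).2 (hP.1 hb)

end BlockPermutations

/-! ### Garnir functions in characteristic two. -/

section Garnir

variable {μ : YoungDiagram} {K : Type*} [Field K] {B : Type*} {M : Type*} [AddCommGroup M]

/-- The boxes in column `j`. -/
def colFinset (μ : YoungDiagram) (j : ℕ) : Finset (Box μ) := univ.filter fun c => c.1.2 = j

theorem mem_colFinset {j : ℕ} {c : Box μ} : c ∈ colFinset μ j ↔ c.1.2 = j := by
  simp [colFinset]

theorem box_lt_colLen (c : Box μ) : c.1.1 < μ.colLen c.1.2 :=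
  YoungDiagram.mem_iff_lt_colLen.1 ((YoungDiagram.mem_cells _).1 c.2)

theorem box_lt_rowLen (c : Box μ) : c.1.2 < μ.rowLen c.1.1 :=
  YoungDiagram.mem_iff_lt_rowLen.1 ((YoungDiagram.mem_cells _).1 c.2)

/-- The box in row `i` and column `j`. -/
def mkBox {i j : ℕ} (h : i < μ.colLen j) : Box μ :=
  ⟨(i, j), (YoungDiagram.mem_cells _).2 (YoungDiagram.mem_iff_lt_colLen.2 h)⟩

theorem box_ext {c c' : Box μ} (h₁ : c.1.1 = c'.1.1) (h₂ : c.1.2 = c'.1.2) : c = c' :=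
  Subtype.ext (Prod.ext h₁ h₂)

theorem card_filter_colFinset (j : ℕ) (p : ℕ → Prop) [DecidablePred p] :
    ((colFinset μ j).filter fun c => p c.1.1).card = ((range (μ.colLen j)).filter p).card := by
  rw [← card_image_of_injOn (f := fun c : Box μ => c.1.1)]
  · congr 1
    ext i
    simp only [mem_image, mem_filter, mem_range, mem_colFinset]
    constructor
    · rintro ⟨c, ⟨rfl, hc⟩, rfl⟩
      exact ⟨box_lt_colLen c, hc⟩
    · rintro ⟨hi, hp⟩
      exact ⟨mkBox hi, ⟨rfl, hp⟩, rfl⟩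
  · intro c hc c' hc' h
    rw [mem_coe, mem_filter, mem_colFinset] at hc hc'
    exact box_ext h (hc.1.trans hc'.1.symm)

theorem card_colFinset (j : ℕ) : (colFinset μ j).card = μ.colLen j := by
  simpa using card_filter_colFinset (μ := μ) j fun _ => True

theorem isColPreserving_mul {σ τ : Equiv.Perm (Box μ)} (hσ : IsColPreserving σ)
    (hτ : IsColPreserving τ) : IsColPreserving (σ * τ) := fun c => by
  rw [Equiv.Perm.mul_apply, hσ, hτ]

theorem isColPreserving_inv {σ : Equiv.Perm (Box μ)} (hσ : IsColPreserving σ) :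
    IsColPreserving σ⁻¹ := fun c => by
  rw [← hσ (σ⁻¹ c)]
  simp

theorem isColPreserving_swap {c c' : Box μ} (h : c.1.2 = c'.1.2) :
    IsColPreserving (Equiv.swap c c') := fun b => by
  rw [Equiv.swap_apply_def]
  split_ifs with h₁ h₂
  · rw [h₁, h]
  · rw [h₂, h]
  · rfl

/-- A function of tableaux which is invariant under column permutations and satisfies the Garnir
relations in characteristic two. -/
structure IsGarnir (F : (Box μ → B) → M) : Prop where
  col : ∀ (t : Box μ → B) (τ : Equiv.Perm (Box μ)), IsColPreserving τ → F (t ∘ τ) = F t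
  garnir : ∀ (t : Box μ → B) (j j' : ℕ) (S T : Finset (Box μ)), j < j' → S ⊆ colFinset μ j →
    T ⊆ colFinset μ j' → μ.colLen j < S.card + T.card →
    ∑ P ∈ (S ∪ T).powersetCard S.card, F (t ∘ blockPerm S (S ∪ T) P) = 0

theorem isColPreserving_of_isBlockPerm {j j' : ℕ} {S T : Finset (Box μ)}
    (hS : S ⊆ colFinset μ j) (hT : T ⊆ colFinset μ j')
    {τ : Equiv.Perm (Box μ)} (h : IsBlockPerm S (S ∪ T) S τ) : IsColPreserving τ := by
  intro b
  by_cases hb : b ∈ S ∪ T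
  · by_cases hbS : b ∈ S
    · rw [mem_colFinset.1 (hS ((h.2 b).2 hbS)), mem_colFinset.1 (hS hbS)]
    · have h₁ : τ b ∉ S := fun hc => hbS ((h.2 b).1 hc)
      have h₂ : τ b ∈ T := (mem_union.1 ((h.mem_iff b).2 hb)).resolve_left h₁
      rw [mem_colFinset.1 (hT h₂), mem_colFinset.1 (hT ((mem_union.1 hb).resolve_left hbS))]
  · rw [h.1 b hb]

/-- In `t ∘ σ` the entry of `t` at `b` sits in the box `σ.symm b`; so the entries of `P` move to
column `j` and those of the rest of `S ∪ T` to column `j'`. -/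
theorem IsBlockPerm.symm_col {j j' : ℕ} {S T P : Finset (Box μ)} {σ : Equiv.Perm (Box μ)}
    (hσ : IsBlockPerm S (S ∪ T) P σ) (hS : S ⊆ colFinset μ j) (hT : T ⊆ colFinset μ j')
    (b : Box μ) :
    (σ.symm b).1.2 = if b ∈ P then j else if b ∈ S ∪ T then j' else b.1.2 := by
  split_ifs with h₁ h₂
  · exact mem_colFinset.1 (hS ((hσ.symm_mem_iff b).2 h₁))
  · have h₃ : σ.symm b ∈ S ∪ T := (hσ.mem_iff _).1 (by simpa using h₂)
    exact mem_colFinset.1 (hT ((mem_union.1 h₃).resolve_left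
      fun h => h₁ ((hσ.symm_mem_iff b).1 h)))
  · have : σ.symm b = b := by rw [Equiv.symm_apply_eq, hσ.1 b h₂]
    rw [this]

/-- Two choices for the same `P` differ by a permutation stabilising `S` and `T`, which preserves
columns. Garnir sums therefore do not depend on the representatives chosen by `blockPerm`. -/
theorem IsGarnir.eq_of_isBlockPerm {F : (Box μ → B) → M} (hF : IsGarnir F) (t : Box μ → B)
    {j j' : ℕ} {S T P : Finset (Box μ)} (hS : S ⊆ colFinset μ j) (hT : T ⊆ colFinset μ j')
    {σ σ' : Equiv.Perm (Box μ)}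
    (h : IsBlockPerm S (S ∪ T) P σ) (h' : IsBlockPerm S (S ∪ T) P σ') :
    F (t ∘ σ) = F (t ∘ σ') := by
  rw [← hF.col (t ∘ σ') (σ'⁻¹ * σ) (isColPreserving_of_isBlockPerm hS hT (h'.inv.mul h))]
  congr 1
  funext b
  simp

theorem add_self_of_charTwo (K : Type*) [Field K] [CharP K 2] {M : Type*} [AddCommGroup M]
    [Module K M] (m : M) : m + m = 0 := by
  rw [← two_smul K m, CharTwo.two_eq_zero, zero_smul]

-- If `x` and `y` carry equal entries, the terms whose `P` separates them pair off under the swap of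
-- `x` and `y` and cancel in characteristic two.
variable (K) in
theorem IsGarnir.sum_filter_eq_zero [CharP K 2] [Module K M] {F : (Box μ → B) → M}
    (hF : IsGarnir F) (t : Box μ → B) {j j' : ℕ} {S T : Finset (Box μ)} (hj : j < j')
    (hS : S ⊆ colFinset μ j) (hT : T ⊆ colFinset μ j') (hcard : μ.colLen j < S.card + T.card)
    {x y : Box μ} (hx : x ∈ S ∪ T) (hy : y ∈ S ∪ T) (hxy : t x = t y) :
    ∑ P ∈ (S ∪ T).powersetCard S.card with (x ∈ P ↔ y ∈ P), F (t ∘ blockPerm S (S ∪ T) P) = 0 := by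
  have h := hF.garnir t j j' S T hj hS hT hcard
  rw [← sum_filter_add_sum_filter_not _ (fun P => x ∈ P ↔ y ∈ P)] at h
  rw [← h, left_eq_add]
  have hsw : ∀ b, Equiv.swap x y b ∈ S ∪ T ↔ b ∈ S ∪ T :=
    (isBlockPerm_swap (P := ∅) hx hy).mem_iff
  refine sum_involution (fun P _ => P.map (Equiv.swap x y).toEmbedding) ?_ ?_ ?_ ?_
  · intro P hP
    have hP' := (mem_filter.1 hP).1
    have e : F (t ∘ blockPerm S (S ∪ T) (P.map (Equiv.swap x y).toEmbedding)) =
        F (t ∘ blockPerm S (S ∪ T) P) := by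
      rw [hF.eq_of_isBlockPerm t hS hT
        (isBlockPerm_blockPerm subset_union_left (powersetCard_map_mem hsw hP'))
        ((isBlockPerm_swap hx hy).mul (isBlockPerm_blockPerm subset_union_left hP'))]
      congr 1
      funext b
      simp only [Function.comp_apply, Equiv.Perm.mul_apply]
      rw [Equiv.swap_apply_def]
      split_ifs with h₁ h₂
      · rw [h₁, hxy]
      · rw [h₂, hxy]
      · rfl
    rw [e, add_self_of_charTwo K]
  · intro P hP _ heq
    refine (mem_filter.1 hP).2 ?_
    conv_lhs => rw [← heq]
    rw [Finset.mem_map_equiv]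
    simp
  · intro P hP
    rw [mem_filter] at hP ⊢
    refine ⟨powersetCard_map_mem hsw hP.1, ?_⟩
    simp only [Finset.mem_map_equiv, Equiv.symm_swap, Equiv.swap_apply_left,
      Equiv.swap_apply_right]
    exact fun h => hP.2 h.symm
  · intro P hP
    ext b
    simp [Finset.mem_map_equiv]

end Garnir

/-! ### Straightening by Garnir relations. -/

section Straightening

variable {μ : YoungDiagram} {K : Type*} [Field K] {N : ℕ} {M : Type*} [AddCommGroup M]

/-- The entries of `t` increase weakly along rows. -/
def RowWeak (t : Box μ → Fin N) : Prop :=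
  ∀ c c' : Box μ, c.1.1 = c'.1.1 → c.1.2 < c'.1.2 → t c ≤ t c'

/-- The entries of `t` increase weakly down columns. -/
def ColWeak (t : Box μ → Fin N) : Prop :=
  ∀ c c' : Box μ, c.1.2 = c'.1.2 → c.1.1 < c'.1.1 → t c ≤ t c'

/-- The entries of `t` are distinct in each column. -/
def ColDistinct {B : Type*} (t : Box μ → B) : Prop :=
  ∀ c c' : Box μ, c.1.2 = c'.1.2 → t c = t c' → c = c'

/-- A permutation leaves the total of `f` unchanged, so `g` may be shifted by any threshold `v`; the
hypotheses say that no large value loses weight and no small value gains any. -/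
theorem sum_mul_perm_lt {α : Type*} [Fintype α] (f g : α → ℤ) (σ : Equiv.Perm α) (v : ℤ)
    (h : ∀ b, 0 ≤ (f (σ.symm b) - f b) * (g b - v))
    (h' : ∃ b, 0 < (f (σ.symm b) - f b) * (g b - v)) :
    ∑ b, f b * g b < ∑ b, f b * g (σ b) := by
  have h₁ : ∑ b, f b * g (σ b) = ∑ b, f (σ.symm b) * g b := by
    rw [← Equiv.sum_comp σ (fun b => f (σ.symm b) * g b)]
    simp
  have h₂ : ∑ b, f (σ.symm b) = ∑ b, f b := Equiv.sum_comp σ.symm f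
  have h₃ : 0 < ∑ b, (f (σ.symm b) - f b) * (g b - v) := by
    obtain ⟨b, hb⟩ := h'
    exact sum_pos' (fun b _ => h b) ⟨b, mem_univ b, hb⟩
  have h₄ : ∑ b, (f (σ.symm b) - f b) * (g b - v) =
      ∑ b, f (σ.symm b) * g b - ∑ b, f b * g b - (∑ b, f (σ.symm b) - ∑ b, f b) * v := by
    rw [← sum_sub_distrib, ← sum_sub_distrib, sum_mul, ← sum_sub_distrib]
    exact sum_congr rfl fun b _ => by ring
  rw [h₂, sub_self, zero_mul, sub_zero] at h₄
  rw [h₁]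
  linarith

theorem exists_colWeak (t : Box μ → Fin N) :
    ∃ τ : Equiv.Perm (Box μ), IsColPreserving τ ∧ ColWeak (t ∘ τ) := by
  -- Sorting by extremality: an inversion in a column could be swapped to increase the sum of row
  -- index times entry.
  obtain ⟨τ, hτ, hmax⟩ := exists_max_image
    (univ.filter fun τ : Equiv.Perm (Box μ) => IsColPreserving τ)
    (fun τ => ∑ c : Box μ, (c.1.1 : ℤ) * ((t (τ c) : ℕ) : ℤ))
    ⟨1, mem_filter.2 ⟨mem_univ _, fun _ => rfl⟩⟩
  rw [mem_filter] at hτ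
  refine ⟨τ, hτ.2, fun c c' hc hcc => ?_⟩
  by_contra hlt
  rw [not_le] at hlt
  have hlt' : ((t (τ c') : ℕ) : ℤ) < ((t (τ c) : ℕ) : ℤ) := by exact_mod_cast hlt
  have hrow : (c.1.1 : ℤ) < c'.1.1 := by exact_mod_cast hcc
  refine absurd (hmax (τ * Equiv.swap c c') ?_) (not_le.2 ?_)
  · rw [mem_filter]
    exact ⟨mem_univ _, isColPreserving_mul hτ.2 (isColPreserving_swap hc)⟩
  · refine sum_mul_perm_lt (fun c : Box μ => (c.1.1 : ℤ)) (fun c => ((t (τ c) : ℕ) : ℤ))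
      (Equiv.swap c c') ((t (τ c') : ℕ) : ℤ) (fun b => ?_) ⟨c, ?_⟩
    · rw [Equiv.symm_swap, Equiv.swap_apply_def]
      split_ifs with h₁ h₂
      · subst h₁
        exact mul_nonneg (by linarith) (by linarith)
      · subst h₂
        simp
      · simp
    · rw [Equiv.symm_swap, Equiv.swap_apply_left]
      exact mul_pos (by linarith) (by linarith)

/-- The classical straightening algorithm: each Garnir step raises the sum of column index times
entry, which is bounded. Since repeated column entries need not vanish, the columns of the result
are only weakly increasing. -/
theorem IsGarnir.mem_span [CharP K 2] [Module K M] {F : (Box μ → Fin N) → M} (hF : IsGarnir F)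
    (t : Box μ → Fin N) :
    F t ∈ Submodule.span K {m | ∃ σ : Equiv.Perm (Box μ),
      RowWeak (t ∘ σ) ∧ ColWeak (t ∘ σ) ∧ F (t ∘ σ) = m} := by
  obtain ⟨bound, hbound⟩ : ∃ bound : ℤ, ∀ t : Box μ → Fin N,
      ∑ c : Box μ, (c.1.2 : ℤ) * ((t c : ℕ) : ℤ) ≤ bound :=
    ⟨∑ c : Box μ, (c.1.2 : ℤ) * (N : ℤ), fun t => sum_le_sum fun c _ =>
      mul_le_mul_of_nonneg_left (by exact_mod_cast (t c).2.le) (by positivity)⟩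
  induction hm : (bound - ∑ c : Box μ, (c.1.2 : ℤ) * ((t c : ℕ) : ℤ)).toNat
    using Nat.strong_induction_on generalizing t with
  | _ m ih =>
  obtain ⟨τ, hτ, hcol⟩ := exists_colWeak t
  by_cases hrow : RowWeak (t ∘ τ)
  · exact Submodule.subset_span ⟨τ, hrow, hcol, hF.col t τ hτ⟩
  have hsum : ∑ c : Box μ, (c.1.2 : ℤ) * ((t (τ c) : ℕ) : ℤ) =
      ∑ c : Box μ, (c.1.2 : ℤ) * ((t c : ℕ) : ℤ) := by
    rw [← Equiv.sum_comp τ (fun c : Box μ => (c.1.2 : ℤ) * ((t c : ℕ) : ℤ))]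
    exact sum_congr rfl fun c _ => by rw [hτ c]
  simp only [RowWeak, not_forall, not_le] at hrow
  obtain ⟨c, c', hrc, hcc, hlt⟩ := hrow
  -- At a row descent, `S` is the left column from `c` downwards and `T` the right column down to
  -- `c'`. Together they have one box more than the left column, and every entry of `S` exceeds
  -- every entry of `T`.
  set S := (colFinset μ c.1.2).filter fun b => c.1.1 ≤ b.1.1 with hSdef
  set T := (colFinset μ c'.1.2).filter fun b => b.1.1 ≤ c'.1.1 with hTdef
  have hS : S ⊆ colFinset μ c.1.2 := filter_subset _ _
  have hT : T ⊆ colFinset μ c'.1.2 := filter_subset _ _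
  have hSc : ∀ b ∈ S, (t ∘ τ) c ≤ (t ∘ τ) b := by
    intro b hb
    rw [hSdef, mem_filter, mem_colFinset] at hb
    rcases hb.2.lt_or_eq with h | h
    · exact hcol c b hb.1.symm h
    · rw [box_ext h hb.1.symm]
  have hTc : ∀ b ∈ T, (t ∘ τ) b ≤ (t ∘ τ) c' := by
    intro b hb
    rw [hTdef, mem_filter, mem_colFinset] at hb
    rcases hb.2.lt_or_eq with h | h
    · exact hcol b c' hb.1 h
    · rw [box_ext h hb.1]
  have hcard : μ.colLen c.1.2 < S.card + T.card := by
    have h₁ : S.card = μ.colLen c.1.2 - c.1.1 := by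
      rw [hSdef, card_filter_colFinset _ (fun i => c.1.1 ≤ i)]
      have : (range (μ.colLen c.1.2)).filter (fun i => c.1.1 ≤ i) =
          Ico c.1.1 (μ.colLen c.1.2) := by
        ext i; simp [and_comm]
      rw [this, Nat.card_Ico]
    have h₂ : T.card = c'.1.1 + 1 := by
      rw [hTdef, card_filter_colFinset _ (fun i => i ≤ c'.1.1)]
      have : (range (μ.colLen c'.1.2)).filter (fun i => i ≤ c'.1.1) = range (c'.1.1 + 1) := by
        ext i
        have := box_lt_colLen c'
        simp only [mem_filter, mem_range]
        omega
      rw [this, card_range]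
    have := box_lt_colLen c
    omega
  have hmem : S ∈ (S ∪ T).powersetCard S.card := mem_powersetCard.2 ⟨subset_union_left, rfl⟩
  have hrel := hF.garnir (t ∘ τ) _ _ S T hcc hS hT hcard
  rw [← add_sum_erase _ _ hmem, hF.eq_of_isBlockPerm (σ' := 1) _ hS hT
    (isBlockPerm_blockPerm subset_union_left hmem) ⟨fun _ _ => rfl, fun _ => Iff.rfl⟩] at hrel
  have hFt : F t = - ∑ P ∈ ((S ∪ T).powersetCard S.card).erase S,
      F ((t ∘ τ) ∘ blockPerm S (S ∪ T) P) := by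
    rw [← hF.col t τ hτ]
    exact eq_neg_of_add_eq_zero_left hrel
  rw [hFt]
  refine Submodule.neg_mem _ (Submodule.sum_mem _ fun P hP => ?_)
  rw [mem_erase] at hP
  have hσ := isBlockPerm_blockPerm subset_union_left hP.2
  set σ := blockPerm S (S ∪ T) P
  have hlt' : ((t (τ c') : ℕ) : ℤ) < ((t (τ c) : ℕ) : ℤ) := by exact_mod_cast hlt
  have hcc' : (c.1.2 : ℤ) < c'.1.2 := by exact_mod_cast hcc
  have hinv := hσ.symm_col hS hT
  -- Any `P ≠ S` sends some entries of `T` left and some larger entries of `S` right; the entry at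
  -- `c` is the threshold.
  have hstep := sum_mul_perm_lt (fun c : Box μ => (c.1.2 : ℤ)) (fun b => ((t (τ b) : ℕ) : ℤ)) σ
    ((t (τ c) : ℕ) : ℤ) (fun b => by
      simp only [hinv]
      by_cases hbS : b ∈ S
      · have h₁ := mem_colFinset.1 (hS hbS)
        have h₂ : ((t (τ c) : ℕ) : ℤ) ≤ ((t (τ b) : ℕ) : ℤ) := by exact_mod_cast hSc b hbS
        refine mul_nonneg ?_ (by linarith)
        rw [h₁]
        split_ifs
        · simp
        · linarith
        · simp
      · by_cases hbT : b ∈ T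
        · have h₁ := mem_colFinset.1 (hT hbT)
          have h₂ : ((t (τ b) : ℕ) : ℤ) ≤ ((t (τ c') : ℕ) : ℤ) := by exact_mod_cast hTc b hbT
          refine mul_nonneg_of_nonpos_of_nonpos ?_ (by linarith)
          rw [h₁]
          split_ifs
          · linarith
          · simp
          · simp
        · have h₁ : b ∉ S ∪ T := by simp [hbS, hbT]
          have h₂ : b ∉ P := fun h => h₁ ((mem_powersetCard.1 hP.2).1 h)
          simp [h₁, h₂]) (by
      obtain ⟨b, hbP, hbS⟩ : ∃ b ∈ P, b ∉ S := by
        by_contra hcon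
        push Not at hcon
        exact hP.1 (eq_of_subset_of_card_le hcon (mem_powersetCard.1 hP.2).2.ge)
      have hbT := (mem_union.1 ((mem_powersetCard.1 hP.2).1 hbP)).resolve_left hbS
      have h₂ : ((t (τ b) : ℕ) : ℤ) ≤ ((t (τ c') : ℕ) : ℤ) := by exact_mod_cast hTc b hbT
      refine ⟨b, ?_⟩
      simp only [hinv, if_pos hbP, mem_colFinset.1 (hT hbT)]
      exact mul_pos_of_neg_of_neg (by linarith) (by linarith))
  have hb := hbound (fun b => t (τ (σ b)))
  have key := ih _ ?_ (t ∘ τ ∘ σ) rfl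
  · refine Submodule.span_mono ?_ key
    rintro _ ⟨ρ, h₁, h₂, rfl⟩
    exact ⟨τ * σ * ρ, h₁, h₂, rfl⟩
  · rw [← hm]
    simp only [Function.comp_apply] at hstep hb ⊢
    have := hbound t
    omega

end Straightening

/-! ### Polytabloids satisfy the Garnir relations. -/

section PolytabloidGarnir

variable {μ : YoungDiagram} {K : Type*} [Field K] {V : Type*} [AddCommGroup V] [Module K V]
  {B : Type*}

theorem placePerm_tableauTensor (b : Module.Basis B K V) (t : Box μ → B)
    (σ : Equiv.Perm (Box μ)) :
    placePerm σ (tableauTensor b t) = tableauTensor b (t ∘ σ) :=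
  placePerm_tprod σ _

/-- The row tabloid of a tableau. -/
def tabloid (b : Module.Basis B K V) (t : Box μ → B) : RowTabloids K V μ :=
  (symRel K V μ).mkQ (tableauTensor b t)

theorem tabloid_comp (b : Module.Basis B K V) (t : Box μ → B) {ρ : Equiv.Perm (Box μ)}
    (hρ : IsRowPreserving ρ) : tabloid b (t ∘ ρ) = tabloid b t := by
  rw [tabloid, tabloid, ← sub_eq_zero, ← map_sub, Submodule.mkQ_apply,
    Submodule.Quotient.mk_eq_zero]
  refine Submodule.subset_span ⟨tableauTensor b t, ρ, hρ, ?_⟩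
  rw [placePerm_tableauTensor]

theorem sign_cast_eq_one (K : Type*) [Field K] [CharP K 2] {α : Type*} [Fintype α] [DecidableEq α]
    (σ : Equiv.Perm α) : ((Equiv.Perm.sign σ : ℤ) : K) = 1 := by
  rcases Int.units_eq_one_or (Equiv.Perm.sign σ) with h | h <;> rw [h]
  · simp
  · simp [CharTwo.neg_eq]

theorem polytabloid_eq_sum [CharP K 2] (b : Module.Basis B K V) (t : Box μ → B) :
    polytabloid b t =
      ∑ σ : Equiv.Perm (Box μ) with IsColPreserving σ, tabloid b (t ∘ σ) := by
  rw [polytabloid, colAntisymmetriser, LinearMap.sum_apply]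
  refine sum_congr rfl fun σ _ => ?_
  rw [sign_cast_eq_one, one_smul, LinearMap.comp_apply, placePerm_tableauTensor]
  rfl

theorem polytabloid_comp [CharP K 2] (b : Module.Basis B K V) (t : Box μ → B)
    {τ : Equiv.Perm (Box μ)} (hτ : IsColPreserving τ) :
    polytabloid b (t ∘ τ) = polytabloid b t := by
  rw [polytabloid_eq_sum, polytabloid_eq_sum]
  refine sum_nbij' (fun σ => τ * σ) (fun σ => τ⁻¹ * σ) ?_ ?_ ?_ ?_ ?_
  · intro σ hσ
    rw [mem_filter] at hσ ⊢
    exact ⟨mem_univ _, isColPreserving_mul hτ hσ.2⟩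
  · intro σ hσ
    rw [mem_filter] at hσ ⊢
    exact ⟨mem_univ _, isColPreserving_mul (isColPreserving_inv hτ) hσ.2⟩
  · intro σ _
    simp
  · intro σ _
    simp
  · intro σ _
    rfl

/-- In characteristic two, a polytabloid with a repeated entry in a column vanishes. -/
theorem polytabloid_eq_zero [CharP K 2] (b : Module.Basis B K V) (t : Box μ → B) {c c' : Box μ}
    (hcc : c ≠ c') (hcol : c.1.2 = c'.1.2) (ht : t c = t c') : polytabloid b t = 0 := by
  rw [polytabloid_eq_sum]
  refine sum_involution (fun σ _ => Equiv.swap c c' * σ) ?_ ?_ ?_ ?_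
  · intro σ _
    have : t ∘ ⇑(Equiv.swap c c' * σ) = t ∘ σ := by
      funext a
      simp only [Function.comp_apply, Equiv.Perm.mul_apply]
      rw [Equiv.swap_apply_def]
      split_ifs with h₁ h₂
      · rw [h₁, ht]
      · rw [h₂, ht]
      · rfl
    rw [this, add_self_of_charTwo K]
  · intro σ _ _ h
    have := mul_eq_right.1 h
    exact hcc (by simpa using Equiv.ext_iff.1 this c')
  · intro σ hσ
    rw [mem_filter] at hσ ⊢
    exact ⟨mem_univ _, isColPreserving_mul (isColPreserving_swap hcol) hσ.2⟩
  · intro σ _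
    simp [← mul_assoc]

/-- The permutations `ρ` of the form `σ * τ` with `σ` supported on `X` and `τ`
column-preserving, where `X` is contained in the union of the columns `j` and `j'`. -/
def IsGarnirPerm (X : Finset (Box μ)) (j j' : ℕ) (ρ : Equiv.Perm (Box μ)) : Prop :=
  (∀ b, ρ b ∉ X → (ρ b).1.2 = b.1.2) ∧ ∀ b, ρ b ∈ X → b.1.2 = j ∨ b.1.2 = j'

/-- Off the preimage of `X`, `ρ` preserves columns, so the complements have equal size in each
column. -/
theorem IsGarnirPerm.card_filter {X : Finset (Box μ)} {j j' : ℕ} {ρ : Equiv.Perm (Box μ)}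
    (hρ : IsGarnirPerm X j j' ρ) (k : ℕ) :
    ((colFinset μ k).filter fun b => ρ b ∈ X).card =
      ((colFinset μ k).filter fun b => b ∈ X).card := by
  have h₁ := card_filter_add_card_filter_not (s := colFinset μ k) fun b => ρ b ∈ X
  have h₂ := card_filter_add_card_filter_not (s := colFinset μ k) fun b => b ∈ X
  have h₃ : ((colFinset μ k).filter fun b => ρ b ∉ X).card =
      ((colFinset μ k).filter fun b => b ∉ X).card := by
    refine card_nbij' (fun b => ρ b) (fun b => ρ.symm b) ?_ ?_ ?_ ?_
    · intro b hb
      rw [mem_coe, mem_filter, mem_colFinset] at hb ⊢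
      exact ⟨(hρ.1 b hb.2).trans hb.1, hb.2⟩
    · intro b hb
      rw [mem_coe, mem_filter, mem_colFinset] at hb ⊢
      have := hρ.1 (ρ.symm b)
      rw [Equiv.apply_symm_apply] at this ⊢
      exact ⟨(this hb.2).symm.trans hb.1, hb.2⟩
    · intro b _
      simp
    · intro b _
      simp
  omega

theorem filter_mem_union_left {j j' : ℕ} {S T : Finset (Box μ)} (hj : j ≠ j')
    (hS : S ⊆ colFinset μ j) (hT : T ⊆ colFinset μ j') :
    (colFinset μ j).filter (fun b => b ∈ S ∪ T) = S := by
  ext b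
  rw [mem_filter, mem_union]
  refine ⟨fun h => h.2.resolve_right fun hb => hj ?_, fun h => ⟨hS h, Or.inl h⟩⟩
  rw [← mem_colFinset.1 h.1, mem_colFinset.1 (hT hb)]

/-- Pigeonhole: the preimage of `X` has `|S|` boxes in column `j` and `|T|` in column `j'`, more
than there are rows available. -/
theorem exists_same_row {X : Finset (Box μ)} {j j' : ℕ} (hj : j < j')
    {ρ : Equiv.Perm (Box μ)} (hρ : IsGarnirPerm X j j' ρ) {S T : Finset (Box μ)}
    (hX : X = S ∪ T) (hS : S ⊆ colFinset μ j) (hT : T ⊆ colFinset μ j')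
    (hcard : μ.colLen j < S.card + T.card) :
    ∃ p : Box μ × Box μ, ρ p.1 ∈ X ∧ ρ p.2 ∈ X ∧ p.1.1.1 = p.2.1.1 ∧
      p.1.1.2 = j ∧ p.2.1.2 = j' := by
  have h₁ := hρ.card_filter j
  have h₂ := hρ.card_filter j'
  rw [hX, filter_mem_union_left hj.ne hS hT] at h₁
  rw [hX, union_comm, filter_mem_union_left hj.ne' hT hS] at h₂
  set S' := (colFinset μ j).filter fun b => ρ b ∈ S ∪ T
  set T' := (colFinset μ j').filter fun b => ρ b ∈ T ∪ S
  have hrow : ∀ k, Set.InjOn (fun c : Box μ => c.1.1) (colFinset μ k) := fun k c hc c' hc' h =>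
    box_ext h ((mem_colFinset.1 hc).trans (mem_colFinset.1 hc').symm)
  have h₃ : (S'.image fun c => c.1.1).card = S'.card :=
    card_image_of_injOn ((hrow j).mono (filter_subset _ _))
  have h₄ : (T'.image fun c => c.1.1).card = T'.card :=
    card_image_of_injOn ((hrow j').mono (filter_subset _ _))
  obtain ⟨i, hi⟩ := inter_nonempty_of_card_lt_card_add_card (s := range (μ.colLen j))
    (t := S'.image fun c => c.1.1) (u := T'.image fun c => c.1.1) (by
      intro i hi
      obtain ⟨c, hc, rfl⟩ := mem_image.1 hi
      rw [mem_filter, mem_colFinset] at hc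
      rw [mem_range, ← hc.1]
      exact box_lt_colLen c) (by
      intro i hi
      obtain ⟨c, hc, rfl⟩ := mem_image.1 hi
      rw [mem_filter, mem_colFinset] at hc
      rw [mem_range]
      refine (box_lt_colLen c).trans_le ?_
      rw [hc.1]
      exact μ.colLen_anti _ _ hj.le) (by rw [card_range, h₃, h₄, h₁, h₂]; exact hcard)
  rw [mem_inter, mem_image, mem_image] at hi
  obtain ⟨⟨c, hc, hci⟩, c', hc', hci'⟩ := hi
  rw [mem_filter, mem_colFinset] at hc hc'
  exact ⟨(c, c'), hX ▸ hc.2, by rw [hX, union_comm]; exact hc'.2, hci.trans hci'.symm, hc.1, hc'.1⟩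

open scoped Classical in
theorem sum_tabloid_garnirPerm [CharP K 2] (b : Module.Basis B K V) (t : Box μ → B)
    {j j' : ℕ} {S T : Finset (Box μ)} (hj : j < j') (hS : S ⊆ colFinset μ j)
    (hT : T ⊆ colFinset μ j') (hcard : μ.colLen j < S.card + T.card) :
    ∑ ρ : Equiv.Perm (Box μ) with IsGarnirPerm (S ∪ T) j j' ρ, tabloid b (t ∘ ρ) = 0 := by
  let good : Finset (Box μ) → Box μ × Box μ → Prop := fun Y p =>
    p.1 ∈ Y ∧ p.2 ∈ Y ∧ p.1.1.1 = p.2.1.1 ∧ p.1.1.2 = j ∧ p.2.1.2 = j'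
  let fib : Equiv.Perm (Box μ) → Finset (Box μ) := fun ρ => univ.filter fun b => ρ b ∈ S ∪ T
  have hmem : ∀ ρ a, a ∈ fib ρ ↔ ρ a ∈ S ∪ T := fun ρ a => by simp [fib]
  have hgood : ∀ ρ, IsGarnirPerm (S ∪ T) j j' ρ → ∃ p, good (fib ρ) p := by
    intro ρ hρ
    obtain ⟨p, h₁, h₂, h₃⟩ := exists_same_row hj hρ rfl hS hT hcard
    exact ⟨p, mem_filter.2 ⟨mem_univ _, h₁⟩, mem_filter.2 ⟨mem_univ _, h₂⟩, h₃⟩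
  -- The swap of two boxes in one row is chosen from the preimage of `X` alone. Composing with it
  -- fixes that preimage, so the same swap is chosen again and the map is an involution.
  let sw : Finset (Box μ) → Equiv.Perm (Box μ) := fun Y =>
    if h : ∃ p, good Y p then Equiv.swap h.choose.1 h.choose.2 else 1
  have hsw : ∀ ρ, IsGarnirPerm (S ∪ T) j j' ρ →
      ∃ p, good (fib ρ) p ∧ sw (fib ρ) = Equiv.swap p.1 p.2 := by
    intro ρ hρ
    have h := hgood ρ hρ
    exact ⟨h.choose, h.choose_spec, dif_pos h⟩
  have hfib : ∀ ρ, IsGarnirPerm (S ∪ T) j j' ρ → fib (ρ * sw (fib ρ)) = fib ρ := by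
    intro ρ hρ
    obtain ⟨p, hp, he⟩ := hsw ρ hρ
    rw [he]
    ext a
    rw [hmem, hmem, Equiv.Perm.mul_apply]
    rw [Equiv.swap_apply_def]
    have h₁ := (hmem _ _).1 hp.1
    have h₂ := (hmem _ _).1 hp.2.1
    split_ifs with e₁ e₂
    · rw [e₁]; exact iff_of_true h₂ h₁
    · rw [e₂]; exact iff_of_true h₁ h₂
    · rfl
  have hsq : ∀ ρ, IsGarnirPerm (S ∪ T) j j' ρ → ρ * sw (fib ρ) * sw (fib ρ) = ρ := by
    intro ρ hρ
    obtain ⟨p, hp, he⟩ := hsw ρ hρ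
    rw [he, mul_assoc, Equiv.swap_mul_self, mul_one]
  refine sum_involution (fun ρ _ => ρ * sw (fib ρ)) ?_ ?_ ?_ ?_
  · intro ρ hρ
    obtain ⟨p, hp, he⟩ := hsw ρ (mem_filter.1 hρ).2
    have hr : IsRowPreserving (sw (fib ρ)) := by
      intro a
      rw [he, Equiv.swap_apply_def]
      split_ifs with e₁ e₂
      · rw [e₁, hp.2.2.1]
      · rw [e₂, hp.2.2.1]
      · rfl
    have : tabloid b (t ∘ ⇑(ρ * sw (fib ρ))) = tabloid b (t ∘ ρ) := tabloid_comp b (t ∘ ρ) hr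
    rw [this, add_self_of_charTwo K]
  · intro ρ hρ _ h
    obtain ⟨p, hp, he⟩ := hsw ρ (mem_filter.1 hρ).2
    have h₁ := mul_eq_left.1 h
    rw [he, Equiv.swap_eq_one_iff] at h₁
    have := hp.2.2.2
    rw [h₁] at this
    exact hj.ne (this.1.symm.trans this.2)
  · intro ρ hρ
    have hρ' := (mem_filter.1 hρ).2
    have hf := hfib ρ hρ'
    obtain ⟨p, hp, he⟩ := hsw ρ hρ'
    have h₁ := (hmem _ _).1 hp.1
    have h₂ := (hmem _ _).1 hp.2.1
    refine mem_filter.2 ⟨mem_univ _, ?_, ?_⟩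
    · intro a ha
      have ha' : ρ a ∉ S ∪ T := by
        have := Finset.ext_iff.1 hf a
        rw [hmem, hmem] at this
        rwa [← this]
      have : sw (fib ρ) a = a := by
        rw [he]
        exact Equiv.swap_apply_of_ne_of_ne (fun e => ha' (e ▸ h₁)) (fun e => ha' (e ▸ h₂))
      rw [Equiv.Perm.mul_apply, this]
      exact hρ'.1 a ha'
    · intro a ha
      have := Finset.ext_iff.1 hf a
      rw [hmem, hmem] at this
      exact hρ'.2 a (this.1 ha)
  · intro ρ hρ
    rw [hfib ρ (mem_filter.1 hρ).2, hsq ρ (mem_filter.1 hρ).2]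

-- Expanding the polytabloids, the products of a block permutation and a column permutation run once
-- through all Garnir permutations.
open scoped Classical in
theorem isGarnir_polytabloid [CharP K 2] (b : Module.Basis B K V) :
    IsGarnir (μ := μ) fun t => polytabloid b t := by
  refine ⟨fun t τ hτ => polytabloid_comp b t hτ, fun t j j' S T hj hS hT hcard => ?_⟩
  rw [← sum_tabloid_garnirPerm b t hj hS hT hcard]
  simp only [polytabloid_eq_sum]
  rw [← sum_product']
  set X := S ∪ T
  have hSX : S ⊆ X := subset_union_left
  have hXcol : ∀ b ∈ X, b ∉ S → b.1.2 = j' := fun b hb hb' =>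
    mem_colFinset.1 (hT ((mem_union.1 hb).resolve_left hb'))
  have hscol : ∀ b ∈ S, b.1.2 = j := fun b hb => mem_colFinset.1 (hS hb)
  -- Recovers `P` from the product: the boxes of `X` whose entries land in column `j`.
  let part : Equiv.Perm (Box μ) → Finset (Box μ) := fun ρ => X.filter fun x => (ρ.symm x).1.2 = j
  have hpart : ∀ ρ, IsGarnirPerm X j j' ρ → part ρ ∈ X.powersetCard S.card := by
    intro ρ hρ
    refine mem_powersetCard.2 ⟨filter_subset _ _, ?_⟩
    have h := hρ.card_filter j
    rw [filter_mem_union_left hj.ne hS hT] at h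
    rw [← h]
    refine card_nbij' (fun b => ρ.symm b) (fun b => ρ b) ?_ ?_ ?_ ?_
    · intro x hx
      rw [mem_coe, mem_filter] at hx ⊢
      exact ⟨mem_colFinset.2 hx.2, by simpa using hx.1⟩
    · intro x hx
      rw [mem_coe, mem_filter, mem_colFinset] at hx
      rw [mem_coe, mem_filter]
      exact ⟨hx.2, by simpa using hx.1⟩
    · intro x _
      simp
    · intro x _
      simp
  refine sum_nbij' (fun q => blockPerm S X q.1 * q.2)
    (fun ρ => (part ρ, (blockPerm S X (part ρ))⁻¹ * ρ)) ?_ ?_ ?_ ?_ ?_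
  · rintro ⟨P, τ⟩ hq
    rw [mem_product, mem_filter] at hq
    have hσ := isBlockPerm_blockPerm hSX hq.1
    have hτ := hq.2.2
    refine mem_filter.2 ⟨mem_univ _, fun a ha => ?_, fun a ha => ?_⟩
    · rw [Equiv.Perm.mul_apply] at ha ⊢
      rw [hσ.mem_iff] at ha
      rw [hσ.1 _ ha]
      exact hτ a
    · rw [Equiv.Perm.mul_apply, hσ.mem_iff] at ha
      have := hτ a
      by_cases h : τ a ∈ S
      · exact Or.inl (this.symm.trans (hscol _ h))
      · exact Or.inr (this.symm.trans (hXcol _ ha h))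
  · intro ρ hρ
    have hρ' := (mem_filter.1 hρ).2
    have hσ := isBlockPerm_blockPerm hSX (hpart ρ hρ')
    rw [mem_product, mem_filter]
    refine ⟨hpart ρ hρ', mem_univ _, fun a => ?_⟩
    change ((blockPerm S X (part ρ)).symm (ρ a)).1.2 = _
    by_cases ha : ρ a ∈ X
    · have h₁ : (blockPerm S X (part ρ)).symm (ρ a) ∈ X := by
        rw [← hσ.mem_iff]
        simpa using ha
      have h₂ := hσ.symm_mem_iff (ρ a)
      have h₃ : ρ a ∈ part ρ ↔ a.1.2 = j := by simp [part, ha]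
      by_cases h : a.1.2 = j
      · rw [h]
        exact hscol _ (h₂.2 (h₃.2 h))
      · rw [(hρ'.2 a ha).resolve_left h]
        exact hXcol _ h₁ fun h' => h (h₃.1 (h₂.1 h'))
    · have : (blockPerm S X (part ρ)).symm (ρ a) = ρ a := by
        rw [Equiv.symm_apply_eq, hσ.1 _ ha]
      rw [this]
      exact hρ'.1 a ha
  · rintro ⟨P, τ⟩ hq
    rw [mem_product, mem_filter] at hq
    have hσ := isBlockPerm_blockPerm hSX hq.1
    have hτ := isColPreserving_inv hq.2.2
    have hPX := (mem_powersetCard.1 hq.1).1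
    have hP : part (blockPerm S X P * τ) = P := by
      ext x
      have h₁ : ((blockPerm S X P * τ).symm x).1.2 = ((blockPerm S X P).symm x).1.2 :=
        hτ _
      rw [mem_filter, h₁, ← hσ.symm_mem_iff]
      constructor
      · rintro ⟨hx, hx'⟩
        by_contra hc
        have := hXcol _ ((hσ.mem_iff _).1 (by simpa using hx)) hc
        exact hj.ne (hx'.symm.trans this)
      · intro hx
        exact ⟨hPX ((hσ.symm_mem_iff x).1 hx), hscol _ hx⟩
    simp only [hP, inv_mul_cancel_left]
  · intro ρ _
    simp
  · rintro ⟨P, τ⟩ _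
    rfl

end PolytabloidGarnir

/-! ### Linear independence of semistandard polytabloids. -/

section LinearIndependence

variable {μ : YoungDiagram} {K : Type*} [Field K] {V : Type*} [AddCommGroup V] [Module K V]
  {N : ℕ}

/-- Semistandard tableaux. -/
def Semistandard (t : Box μ → Fin N) : Prop := RowWeak t ∧ ColWeak t ∧ ColDistinct t

/-- The number of entries `v` in row `i`. -/
def rowContent (t : Box μ → Fin N) (i : ℕ) (v : Fin N) : ℕ :=
  (univ.filter fun c : Box μ => c.1.1 = i ∧ t c = v).card

theorem rowContent_comp (t : Box μ → Fin N) {ρ : Equiv.Perm (Box μ)} (hρ : IsRowPreserving ρ) :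
    rowContent (t ∘ ρ) = rowContent t := by
  funext i v
  refine card_nbij' (fun b => ρ b) (fun b => ρ.symm b) ?_ ?_ ?_ ?_
  · intro b hb
    rw [mem_coe, mem_filter] at hb ⊢
    exact ⟨mem_univ _, (hρ b).trans hb.2.1, hb.2.2⟩
  · intro b hb
    rw [mem_coe, mem_filter] at hb ⊢
    have := hρ (ρ.symm b)
    rw [Equiv.apply_symm_apply] at this
    exact ⟨mem_univ _, this.symm.trans hb.2.1, by simpa using hb.2.2⟩
  · intro b _
    simp
  · intro b _
    simp

theorem card_row_le_entry (t : Box μ → Fin N) (i : ℕ) (v : Fin N) :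
    (univ.filter fun c : Box μ => c.1.1 = i ∧ t c ≤ v).card =
      ∑ w ∈ univ.filter (· ≤ v), rowContent t i w := by
  rw [card_eq_sum_card_fiberwise (f := t) (t := univ.filter (· ≤ v))]
  · refine sum_congr rfl fun w hw => ?_
    rw [rowContent]
    congr 1
    ext c
    simp only [mem_filter, mem_univ, true_and] at hw ⊢
    constructor
    · rintro ⟨⟨h₁, _⟩, h₃⟩
      exact ⟨h₁, h₃⟩
    · rintro ⟨h₁, h₃⟩
      exact ⟨⟨h₁, h₃ ▸ hw⟩, h₃⟩
  · intro c hc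
    simpa using (mem_filter.1 hc).2.2

/-- A tableau whose rows increase weakly is determined by the contents of its rows. -/
theorem eq_of_rowContent_eq {t s : Box μ → Fin N} (ht : RowWeak t) (hs : RowWeak s)
    (h : rowContent t = rowContent s) : t = s := by
  have key : ∀ {t s : Box μ → Fin N}, RowWeak t → RowWeak s → rowContent t = rowContent s →
      ∀ c, t c ≤ s c := by
    intro t s ht hs h c
    by_contra hlt
    rw [not_le] at hlt
    have hcard := card_row_le_entry t c.1.1 (s c)
    rw [h, ← card_row_le_entry] at hcard
    -- If `t c > s c`, the boxes of this row with `t`-entry at most `s c` all lie left of `c`, where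
    -- `s` is also at most `s c`; the box `c` makes the inclusion strict.
    refine absurd hcard (Nat.ne_of_lt (card_lt_card ?_))
    rw [ssubset_iff_of_subset]
    · refine ⟨c, by simp, by simpa using hlt⟩
    · intro a ha
      simp only [mem_filter, mem_univ, true_and] at ha ⊢
      refine ⟨ha.1, ?_⟩
      have hac : a.1.2 < c.1.2 := by
        by_contra hca
        rw [not_lt] at hca
        rcases hca.lt_or_eq with h₁ | h₁
        · exact absurd ((ht c a ha.1.symm h₁).trans ha.2) (not_le.2 hlt)
        · rw [← box_ext ha.1.symm h₁] at ha
          exact absurd ha.2 (not_le.2 hlt)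
      exact hs a c ha.1 hac
  funext c
  exact le_antisymm (key ht hs h c) (key hs ht h.symm c)

/-- The weight of a tableau: large if its large entries are in low rows. -/
def rowWeight (t : Box μ → Fin N) : ℕ := ∑ c : Box μ, c.1.1 * (t c : ℕ)

/-- Makes `rowWeight` an invariant of the row tabloid. -/
theorem rowWeight_eq (t : Box μ → Fin N) :
    rowWeight t = ∑ i ∈ range (μ.colLen 0), ∑ v : Fin N, rowContent t i v * (i * (v : ℕ)) := by
  rw [← sum_product', rowWeight, ← sum_fiberwise_of_maps_to (s := univ)
    (t := range (μ.colLen 0) ×ˢ (univ : Finset (Fin N))) (g := fun c : Box μ => (c.1.1, t c))]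
  · refine sum_congr rfl fun q _ => ?_
    rw [rowContent, ← smul_eq_mul (_ : ℕ) (q.1 * _), ← sum_const]
    refine sum_congr ?_ fun c hc => ?_
    · ext c
      simp [Prod.ext_iff]
    · have := (mem_filter.1 hc).2
      rw [← this.1, ← this.2]
  · intro c _
    simp only [mem_product, mem_range, mem_univ, and_true]
    exact (box_lt_colLen c).trans_le (μ.colLen_anti _ _ (Nat.zero_le _))

/-- Among the column rearrangements of a column-strict tableau, its own row weight is the
unique largest one. -/
theorem rowWeight_comp_lt {t : Box μ → Fin N} (hc : ColWeak t) (hd : ColDistinct t)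
    {σ : Equiv.Perm (Box μ)} (hσ : IsColPreserving σ) (hne : σ ≠ 1) :
    rowWeight (t ∘ σ) < rowWeight t := by
  set L := μ.colLen 0
  -- Adding large multiples of the column index makes `f` and `g` vary together over the whole
  -- diagram, so that a single rearrangement inequality treats all columns at once.
  let f : Box μ → ℕ := fun c => c.1.1 + L * c.1.2
  let g : Box μ → ℕ := fun c => (t c : ℕ) + N * c.1.2
  have hstrict : ∀ c c' : Box μ, c.1.2 = c'.1.2 → c.1.1 < c'.1.1 → t c < t c' := by
    intro c c' h₁ h₂
    refine (hc c c' h₁ h₂).lt_of_ne fun h => h₂.ne ?_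
    rw [hd c c' h₁ h]
  have hrow : ∀ c : Box μ, c.1.1 < L := fun c =>
    (box_lt_colLen c).trans_le (μ.colLen_anti _ _ (Nat.zero_le _))
  have hmono : Monovary f g := by
    intro c c' h
    simp only [f, g] at h ⊢
    have h₁ := hrow c
    rcases lt_trichotomy c.1.2 c'.1.2 with h₂ | h₂ | h₂
    · have : L * (c.1.2 + 1) ≤ L * c'.1.2 := Nat.mul_le_mul_left _ h₂
      rw [mul_add] at this
      omega
    · rw [h₂] at h ⊢
      have : c.1.1 ≤ c'.1.1 := by
        by_contra hlt
        have := hstrict c' c h₂.symm (by omega)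
        rw [Fin.lt_def] at this
        omega
      omega
    · exfalso
      have : N * (c'.1.2 + 1) ≤ N * c.1.2 := Nat.mul_le_mul_left _ h₂
      rw [mul_add] at this
      have := (t c').2
      omega
  have hnot : ¬ Monovary f (g ∘ σ) := by
    intro hcon
    have hex : (univ.filter fun c : Box μ => σ c ≠ c).Nonempty := by
      by_contra hemp
      refine hne (Equiv.ext fun c => ?_)
      by_contra hcc
      exact hemp ⟨c, mem_filter.2 ⟨mem_univ _, hcc⟩⟩
    -- For a moved box `c` in the topmost possible row, both `σ c` and `σ.symm c` lie below `c`;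
    -- comparing `σ.symm c` with `c` shows that monotonicity fails.
    obtain ⟨c, hcm, hmin⟩ := exists_min_image _ (fun c : Box μ => c.1.1) hex
    have hσc := (mem_filter.1 hcm).2
    have hlow : ∀ a : Box μ, σ a ≠ a → a.1.2 = c.1.2 → a ≠ c → c.1.1 < a.1.1 := by
      intro a ha hac hne'
      refine (hmin a (mem_filter.2 ⟨mem_univ _, ha⟩)).lt_of_ne fun h => hne' ?_
      exact (box_ext h hac.symm).symm
    have h₁ : c.1.1 < (σ c).1.1 := hlow _ (fun h => hσc (σ.injective h)) (hσ c) hσc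
    have hc'' : σ (σ.symm c) = c := σ.apply_symm_apply c
    have hcol' : (σ.symm c).1.2 = c.1.2 := by
      rw [← hσ (σ.symm c), hc'']
    have h₂ : c.1.1 < (σ.symm c).1.1 := by
      refine hlow _ (fun h => hσc ?_) hcol' (fun h => hσc ?_)
      · rw [hc''] at h
        rw [← h] at hc''
        rw [h] at hc''
        conv_lhs => rw [h]
        rw [hc'', ← h]
      · conv_lhs => rw [← h]
        exact hc''
    have h₃ := hstrict c (σ c) (hσ c).symm h₁
    have h₄ := @hcon (σ.symm c) c (by
      simp only [g, Function.comp_apply, hc'', hσ c]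
      rw [Fin.lt_def] at h₃
      omega)
    simp only [f, hcol'] at h₄
    omega
  have hlt := (hmono.sum_mul_comp_perm_lt_sum_mul_iff (σ := σ)).2 hnot
  have hexp : ∀ ρ : Equiv.Perm (Box μ), IsColPreserving ρ → ∑ c, f c * g (ρ c) =
      rowWeight (t ∘ ρ) + ∑ c : Box μ, (c.1.1 * (N * c.1.2) + L * c.1.2 * (N * c.1.2)) +
        L * ∑ c : Box μ, c.1.2 * (t c : ℕ) := by
    intro ρ hρ
    have h₁ : ∑ c : Box μ, c.1.2 * (t c : ℕ) = ∑ c : Box μ, c.1.2 * (t (ρ c) : ℕ) := by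
      rw [← Equiv.sum_comp ρ]
      exact sum_congr rfl fun c _ => by rw [hρ c]
    rw [h₁, rowWeight, mul_sum, ← sum_add_distrib, ← sum_add_distrib]
    refine sum_congr rfl fun c _ => ?_
    simp only [f, g, hρ c, Function.comp_apply]
    ring
  have h₁ := hexp σ hσ
  have h₂ := hexp 1 fun _ => rfl
  simp only [Equiv.Perm.coe_one, Function.comp_id, id] at h₂
  rw [h₁, h₂] at hlt
  omega

open scoped Classical in
/-- The coefficient of a row tabloid. -/
theorem exists_tabloid_coeff (b : Module.Basis (Fin N) K V) (s : Box μ → Fin N) :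
    ∃ ℓ : RowTabloids K V μ →ₗ[K] K, ∀ t : Box μ → Fin N,
      ℓ (tabloid b t) = if rowContent t = rowContent s then 1 else 0 := by
  let e := Basis.piTensorProduct fun _ : Box μ => b
  have he : ∀ t : Box μ → Fin N, e t = tableauTensor b t := fun t =>
    Basis.piTensorProduct_apply _ _
  let ℓ₀ : (⨂[K] _ : Box μ, V) →ₗ[K] K :=
    e.constr K fun t => if rowContent t = rowContent s then 1 else 0
  have hℓ₀ : ∀ t : Box μ → Fin N,
      ℓ₀ (tableauTensor b t) = if rowContent t = rowContent s then 1 else 0 := by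
    intro t
    rw [← he, Module.Basis.constr_basis]
  refine ⟨(symRel K V μ).liftQ ℓ₀ ?_, fun t => ?_⟩
  · refine Submodule.span_le.2 ?_
    rintro _ ⟨x, σ, hσ, rfl⟩
    have : ℓ₀ ∘ₗ placePerm σ = ℓ₀ := by
      refine e.ext fun t => ?_
      rw [LinearMap.comp_apply, he]
      rw [placePerm_tableauTensor, hℓ₀, hℓ₀, rowContent_comp t hσ]
    rw [SetLike.mem_coe, LinearMap.mem_ker, map_sub, sub_eq_zero]
    exact LinearMap.congr_fun this x
  · exact hℓ₀ t

theorem linearIndependent_polytabloid [CharP K 2] (b : Module.Basis (Fin N) K V) :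
    LinearIndependent K fun t : {t : Box μ → Fin N // Semistandard t} => polytabloid b t.1 := by
  classical
  rw [linearIndependent_iff']
  intro A a hsum
  by_contra hcon
  push Not at hcon
  obtain ⟨s₀, hs₀, has₀⟩ := hcon
  -- With `s` of largest weight, the tabloid of `s` occurs in the polytabloid of `s` exactly once,
  -- and in no other polytabloid with nonzero coefficient in the relation.
  obtain ⟨s, hs, hmax⟩ := exists_max_image (A.filter fun t => a t ≠ 0)
    (fun t => rowWeight t.1) ⟨s₀, mem_filter.2 ⟨hs₀, has₀⟩⟩
  rw [mem_filter] at hs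
  obtain ⟨ℓ, hℓ⟩ := exists_tabloid_coeff b s.1
  have hrw : ∀ {t t' : Box μ → Fin N}, rowContent t = rowContent t' →
      rowWeight t = rowWeight t' := fun h => by rw [rowWeight_eq, rowWeight_eq, h]
  have hself : ℓ (polytabloid b s.1) = 1 := by
    rw [polytabloid_eq_sum, map_sum]
    simp only [hℓ]
    rw [sum_eq_single 1]
    · simp
    · intro σ hσ hne
      rw [if_neg]
      intro h
      exact (rowWeight_comp_lt s.2.2.1 s.2.2.2 (mem_filter.1 hσ).2 hne).ne (hrw h)
    · intro h
      exact absurd (mem_filter.2 ⟨mem_univ _, fun _ => rfl⟩) h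
  have hother : ∀ t ∈ A, t ≠ s → a t * ℓ (polytabloid b t.1) = 0 := by
    intro t ht hne
    by_cases hat : a t = 0
    · rw [hat, zero_mul]
    have hle := hmax t (mem_filter.2 ⟨ht, hat⟩)
    rw [polytabloid_eq_sum, map_sum]
    simp only [hℓ]
    rw [sum_eq_zero, mul_zero]
    intro σ hσ
    rw [if_neg]
    intro h
    by_cases h1 : σ = 1
    · subst h1
      exact hne (Subtype.ext (eq_of_rowContent_eq t.2.1 s.2.1 h))
    · have := rowWeight_comp_lt t.2.2.1 t.2.2.2 (mem_filter.1 hσ).2 h1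
      rw [hrw h] at this
      omega
  have := congrArg ℓ hsum
  rw [map_sum, map_zero] at this
  simp only [map_smul, smul_eq_mul] at this
  rw [sum_eq_single_of_mem s hs.1 hother, hself, mul_one] at this
  exact hs.2 this

end LinearIndependence

/-! ### Operations on Garnir functions. -/

section GarnirClosure

variable {μ : YoungDiagram} {B B' : Type*} {M M' : Type*} [AddCommGroup M] [AddCommGroup M']

theorem IsGarnir.prodMk {F : (Box μ → B) → M} {F' : (Box μ → B) → M'} (hF : IsGarnir F)
    (hF' : IsGarnir F') : IsGarnir fun t => (F t, F' t) := by
  refine ⟨fun t τ hτ => by rw [hF.col t τ hτ, hF'.col t τ hτ],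
    fun t j j' S T hj hS hT hcard => ?_⟩
  rw [Prod.ext_iff, Prod.fst_sum, Prod.snd_sum]
  exact ⟨hF.garnir t j j' S T hj hS hT hcard, hF'.garnir t j j' S T hj hS hT hcard⟩

theorem IsGarnir.comp_entries {F : (Box μ → B') → M} (hF : IsGarnir F) (w : B → B') :
    IsGarnir fun t : Box μ → B => F (w ∘ t) :=
  ⟨fun t τ hτ => hF.col (w ∘ t) τ hτ,
    fun t j j' S T hj hS hT hcard => hF.garnir (w ∘ t) j j' S T hj hS hT hcard⟩

end GarnirClosure

/-! ### The universal property of the balanced tensor product. -/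

section BalancedTensors

variable {K : Type*} [Field K] {V : Type*} [AddCommGroup V] [Module K V] {n : ℕ}
  {U : Type*} [AddCommGroup U] [Module K U] {M : Type*} [AddCommGroup M] [Module K M]

/-- The class of `x ⊗ u` in `V^{⊗ n} ⊗_{K S_n} U`, as a bilinear map. -/
def balancedMk (τ : Representation K (Equiv.Perm (Fin n)) U) :
    (⨂[K] _ : Fin n, V) →ₗ[K] U →ₗ[K] BalancedTensor V τ :=
  (TensorProduct.mk K (⨂[K] _ : Fin n, V) U).compr₂ (balancedRel V τ).mkQ

theorem balancedMk_placePerm (τ : Representation K (Equiv.Perm (Fin n)) U)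
    (σ : Equiv.Perm (Fin n)) (x : ⨂[K] _ : Fin n, V) (u : U) :
    balancedMk τ (placePerm σ x) u = balancedMk τ x (τ σ u) := by
  change (balancedRel V τ).mkQ _ = (balancedRel V τ).mkQ _
  rw [← sub_eq_zero, ← map_sub, Submodule.mkQ_apply, Submodule.Quotient.mk_eq_zero]
  exact Submodule.subset_span ⟨σ, x, u, rfl⟩

theorem balancedTensor_hom_ext {τ : Representation K (Equiv.Perm (Fin n)) U}
    {Φ Φ' : BalancedTensor V τ →ₗ[K] M}
    (h : (balancedMk τ).compr₂ Φ = (balancedMk τ).compr₂ Φ') : Φ = Φ' :=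
  Submodule.linearMap_qext _ (TensorProduct.ext h)

theorem exists_balancedLift (τ : Representation K (Equiv.Perm (Fin n)) U)
    (Ψ : (⨂[K] _ : Fin n, V) →ₗ[K] U →ₗ[K] M)
    (h : ∀ σ : Equiv.Perm (Fin n), Ψ ∘ₗ placePerm σ = Ψ.compl₂ (τ σ)) :
    ∃ Φ : BalancedTensor V τ →ₗ[K] M, ∀ (x : ⨂[K] _ : Fin n, V) (u : U),
      Φ (balancedMk τ x u) = Ψ x u := by
  refine ⟨(balancedRel V τ).liftQ (TensorProduct.lift Ψ) ?_, fun x u => TensorProduct.lift.tmul x u⟩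
  refine Submodule.span_le.2 ?_
  rintro _ ⟨σ, x, u, rfl⟩
  rw [SetLike.mem_coe, LinearMap.mem_ker, map_sub, TensorProduct.lift.tmul,
    TensorProduct.lift.tmul, sub_eq_zero]
  exact LinearMap.congr_fun (LinearMap.congr_fun (h σ) x) u

end BalancedTensors

/-! ### The universal Garnir function. -/

section Universal

variable {μ : YoungDiagram} {K : Type*} [Field K] {M : Type*} [AddCommGroup M] [Module K M]

/-- A Garnir function on tableaux with distinct entries factors through the polytabloids. -/
theorem IsGarnir.exists_linearMap [CharP K 2] {V : Type*} [AddCommGroup V] [Module K V] {N : ℕ}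
    (b : Module.Basis (Fin N) K V) {F : (Box μ → Fin N) → M} (hF : IsGarnir F) :
    ∃ L : RowTabloids K V μ →ₗ[K] M, ∀ t : Box μ → Fin N, Function.Injective t →
      L (polytabloid b t) = F t := by
  have hli := linearIndependent_polytabloid (μ := μ) b
  obtain ⟨L, hL⟩ := LinearMap.exists_extend
    (Finsupp.linearCombination K (fun t : {t : Box μ → Fin N // Semistandard t} => F t.1) ∘ₗ
      hli.repr)
  have hss : ∀ t : {t : Box μ → Fin N // Semistandard t}, L (polytabloid b t.1) = F t.1 := by
    intro t
    have h := LinearMap.congr_fun hL ⟨polytabloid b t.1, Submodule.subset_span ⟨t, rfl⟩⟩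
    rw [LinearMap.comp_apply, LinearMap.comp_apply, hli.repr_eq_single t _ rfl,
      Finsupp.linearCombination_single, one_smul] at h
    exact h
  refine ⟨L, fun t ht => ?_⟩
  -- Straightening the pair of functions uses the same coefficients for both. Rearrangements of an
  -- injective tableau have distinct column entries, so the terms are semistandard and lie on the
  -- graph of `L`.
  have hmem := ((isGarnir_polytabloid b).prodMk hF).mem_span (K := K) t
  have hle : Submodule.span K {m | ∃ σ : Equiv.Perm (Box μ), RowWeak (t ∘ σ) ∧
      ColWeak (t ∘ σ) ∧ (polytabloid b (t ∘ σ), F (t ∘ σ)) = m} ≤ L.graph := by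
    refine Submodule.span_le.2 ?_
    rintro _ ⟨σ, h₁, h₂, rfl⟩
    rw [SetLike.mem_coe, LinearMap.mem_graph_iff]
    exact (hss ⟨t ∘ σ, h₁, h₂, fun c c' _ h => (ht.comp σ.injective) h⟩).symm
  exact ((LinearMap.mem_graph_iff _ _).1 (hle hmem)).symm

variable (K) in
/-- The polytabloid of a tableau with distinct entries, as an element of the Specht module. -/
def spechtPolytabloid (t : Box μ → Fin μ.card) (ht : Function.Injective t) :
    (specht K μ).toSubmodule :=
  ⟨polytabloid (Pi.basisFun K (Fin μ.card)) t, Submodule.subset_span ⟨t, ht, rfl⟩⟩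

theorem span_spechtPolytabloid :
    Submodule.span K {z | ∃ (t : Box μ → Fin μ.card) (ht : Function.Injective t),
      z = spechtPolytabloid K t ht} = ⊤ := by
  rw [← top_le_iff, ← Submodule.map_le_map_iff_of_injective
    (specht K μ).toSubmodule.injective_subtype, Submodule.map_subtype_top, Submodule.map_span]
  refine Submodule.span_mono ?_
  rintro _ ⟨t, ht, rfl⟩
  exact ⟨spechtPolytabloid K t ht, ⟨t, ht, rfl⟩, rfl⟩

theorem specht_apply_spechtPolytabloid (σ : Equiv.Perm (Fin μ.card)) (t : Box μ → Fin μ.card)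
    (ht : Function.Injective t) :
    (specht K μ).toRepresentation σ (spechtPolytabloid K t ht) =
      spechtPolytabloid K (fun c => σ (t c)) (σ.injective.comp ht) := by
  refine Subtype.ext ?_
  change rowTabloidRep μ (permRep K μ.card) σ (polytabloid _ t) = polytabloid _ _
  rw [polytabloid, rowTabloidRep_colAntisymmetriser, polytabloid]
  congr 1
  simp only [tableauTensor, tensorRep, MonoidHom.coe_mk, OneHom.coe_mk,
    PiTensorProduct.map_tprod, permRep_basisFun]

/-- The basis of the tensor power given by words in the standard basis. -/
def wordBasis (K : Type*) [Field K] (n d : ℕ) :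
    Module.Basis (Fin n → Fin d) K (⨂[K] _ : Fin n, (Fin d → K)) :=
  Basis.piTensorProduct fun _ => Pi.basisFun K (Fin d)

theorem wordBasis_apply {n d : ℕ} (w : Fin n → Fin d) :
    wordBasis K n d w = PiTensorProduct.tprod K fun i => Pi.basisFun K (Fin d) (w i) :=
  Basis.piTensorProduct_apply _ _

theorem placePerm_wordBasis {n d : ℕ} (σ : Equiv.Perm (Fin n)) (w : Fin n → Fin d) :
    placePerm σ (wordBasis K n d w) = wordBasis K n d (w ∘ σ) := by
  rw [wordBasis_apply, wordBasis_apply, placePerm_tprod]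
  rfl

/-- The underlying space of `E^{⊗ n} ⊗_{K S_n} S^μ`. -/
abbrev SpechtImage (K : Type*) [Field K] (μ : YoungDiagram) (d : ℕ) : Type _ :=
  BalancedTensor (Fin d → K) (specht K μ).toRepresentation

/-- The class of `x ⊗ u`. -/
abbrev pureClass {d : ℕ} : (⨂[K] _ : Fin μ.card, (Fin d → K)) →ₗ[K]
    (specht K μ).toSubmodule →ₗ[K] SpechtImage K μ d :=
  balancedMk (specht K μ).toRepresentation

theorem SpechtImage.hom_ext {d : ℕ} {Φ Φ' : SpechtImage K μ d →ₗ[K] M}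
    (h : ∀ (w : Fin μ.card → Fin d) (t : Box μ → Fin μ.card) (ht : Function.Injective t),
      Φ (pureClass (wordBasis K _ d w) (spechtPolytabloid K t ht)) =
        Φ' (pureClass (wordBasis K _ d w) (spechtPolytabloid K t ht))) : Φ = Φ' := by
  refine balancedTensor_hom_ext ((wordBasis K _ d).ext fun w => ?_)
  refine LinearMap.ext_on span_spechtPolytabloid ?_
  rintro _ ⟨t, ht, rfl⟩
  exact h w t ht

/-- `E^{⊗ n} ⊗_{K S_n} S^μ` is universal for Garnir functions. -/
theorem IsGarnir.exists_lift [CharP K 2] {d : ℕ} {F : (Box μ → Fin d) → M} (hF : IsGarnir F) :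
    ∃ Φ : SpechtImage K μ d →ₗ[K] M,
      ∀ (w : Fin μ.card → Fin d) (t : Box μ → Fin μ.card) (ht : Function.Injective t),
        Φ (pureClass (wordBasis K _ d w) (spechtPolytabloid K t ht)) = F (w ∘ t) := by
  choose L hL using fun w : Fin μ.card → Fin d =>
    (hF.comp_entries w).exists_linearMap (Pi.basisFun K (Fin μ.card))
  let Ψ : (⨂[K] _ : Fin μ.card, (Fin d → K)) →ₗ[K] (specht K μ).toSubmodule →ₗ[K] M :=
    (wordBasis K μ.card d).constr K fun w => L w ∘ₗ (specht K μ).toSubmodule.subtype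
  have hΨ : ∀ w t (ht : Function.Injective t),
      Ψ (wordBasis K _ d w) (spechtPolytabloid K t ht) = F (w ∘ t) := by
    intro w t ht
    simp only [Ψ, Module.Basis.constr_basis]
    exact hL w t ht
  have hbal : ∀ σ : Equiv.Perm (Fin μ.card),
      Ψ ∘ₗ placePerm σ = Ψ.compl₂ ((specht K μ).toRepresentation σ) := by
    intro σ
    refine (wordBasis K _ d).ext fun w => LinearMap.ext_on span_spechtPolytabloid ?_
    rintro _ ⟨t, ht, rfl⟩
    rw [LinearMap.comp_apply, placePerm_wordBasis, hΨ, LinearMap.compl₂_apply,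
      specht_apply_spechtPolytabloid, hΨ]
    rfl
  obtain ⟨Φ, hΦ⟩ := exists_balancedLift (specht K μ).toRepresentation Ψ hbal
  exact ⟨Φ, fun w t ht => by rw [hΦ, hΨ]⟩

/-- A tableau of shape `μ` with entries `1, …, n`. -/
def someTableau (μ : YoungDiagram) : Box μ ≃ Fin μ.card :=
  Fintype.equivFinOfCardEq (Fintype.card_coe μ.cells)

/-- The element of `E^{⊗ n} ⊗_{K S_n} S^μ` given by a tableau with entries in `{1, …, d}`. -/
def tableauClass (K : Type*) [Field K] {μ : YoungDiagram} {d : ℕ} (s : Box μ → Fin d) :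
    SpechtImage K μ d :=
  pureClass (wordBasis K _ d (s ∘ (someTableau μ).symm))
    (spechtPolytabloid K (someTableau μ) (someTableau μ).injective)

/-- Moving a permutation across the tensor sign shows that the class depends only on `w ∘ t`; in
particular the choice of `someTableau` is immaterial. -/
theorem pureClass_wordBasis {d : ℕ} (w : Fin μ.card → Fin d) (t : Box μ → Fin μ.card)
    (ht : Function.Injective t) :
    pureClass (wordBasis K _ d w) (spechtPolytabloid K t ht) = tableauClass K (w ∘ t) := by
  have hb : Function.Bijective t := (Fintype.bijective_iff_injective_and_card t).2
    ⟨ht, by rw [Fintype.card_fin]; exact Fintype.card_coe μ.cells⟩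
  let σ : Equiv.Perm (Fin μ.card) := (someTableau μ).symm.trans (Equiv.ofBijective t hb)
  have h := specht_apply_spechtPolytabloid (K := K) σ (someTableau μ) (someTableau μ).injective
  have h' : spechtPolytabloid K (fun c => σ (someTableau μ c))
      (σ.injective.comp (someTableau μ).injective) = spechtPolytabloid K t ht := by
    congr 1
    funext c
    simp [σ]
  rw [← h', ← h, ← balancedMk_placePerm, placePerm_wordBasis]
  rfl

theorem isGarnir_tableauClass [CharP K 2] (d : ℕ) :
    IsGarnir fun s : Box μ → Fin d => tableauClass K s := by
  have hperm : ∀ (s : Box μ → Fin d) (σ : Equiv.Perm (Box μ)), tableauClass K (s ∘ σ) =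
      pureClass (wordBasis K _ d (s ∘ (someTableau μ).symm)) (spechtPolytabloid K
        (someTableau μ ∘ σ) ((someTableau μ).injective.comp σ.injective)) := by
    intro s σ
    rw [pureClass_wordBasis]
    congr 1
    funext c
    simp
  have hG := isGarnir_polytabloid (μ := μ) (Pi.basisFun K (Fin μ.card))
  refine ⟨fun s τ hτ => ?_, fun s j j' S T hj hS hT hcard => ?_⟩
  · rw [hperm, tableauClass]
    congr 1
    exact Subtype.ext (hG.col _ τ hτ)
  · simp only [hperm]
    rw [← map_sum]
    refine (congrArg _ (Subtype.ext ?_)).trans (LinearMap.map_zero _)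
    rw [AddSubmonoidClass.coe_finsetSum]
    exact hG.garnir (someTableau μ) j j' S T hj hS hT hcard

theorem span_tableauClass (d : ℕ) :
    Submodule.span K (Set.range fun s : Box μ → Fin d => tableauClass K s) = ⊤ := by
  have h : (Submodule.span K (Set.range fun s : Box μ → Fin d => tableauClass K s)).mkQ = 0 := by
    refine SpechtImage.hom_ext fun w t ht => ?_
    rw [pureClass_wordBasis, LinearMap.zero_apply, Submodule.mkQ_apply,
      Submodule.Quotient.mk_eq_zero]
    exact Submodule.subset_span ⟨_, rfl⟩
  rw [← Submodule.ker_mkQ (Submodule.span K _), h, LinearMap.ker_zero]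

end Universal

/-! ### The surjection and a criterion for bijectivity. -/

section Surjection

variable {μ : YoungDiagram} {K : Type*} [Field K]

variable (K) in
/-- A polytabloid as an element of the dual Weyl module. -/
def weylPolytabloid {d : ℕ} (s : Box μ → Fin d) : (dualWeyl K μ d).toSubmodule :=
  ⟨polytabloid (Pi.basisFun K (Fin d)) s, Submodule.subset_span ⟨s, rfl⟩⟩

theorem isGarnir_weylPolytabloid [CharP K 2] (d : ℕ) :
    IsGarnir fun s : Box μ → Fin d => weylPolytabloid K s := by
  have hG := isGarnir_polytabloid (μ := μ) (Pi.basisFun K (Fin d))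
  refine ⟨fun s τ hτ => Subtype.ext (hG.col s τ hτ),
    fun s j j' S T hj hS hT hcard => Subtype.ext ?_⟩
  rw [AddSubmonoidClass.coe_finsetSum]
  exact hG.garnir s j j' S T hj hS hT hcard

variable (K) in
/-- Placing the factors of a tensor into the boxes of a tableau. -/
def placeInBoxes (t : Box μ ≃ Fin μ.card) (d : ℕ) :
    (⨂[K] _ : Fin μ.card, (Fin d → K)) →ₗ[K] (⨂[K] _ : Box μ, (Fin d → K)) :=
  (PiTensorProduct.reindex K (fun _ : Fin μ.card => (Fin d → K)) t.symm).toLinearMap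

theorem placeInBoxes_tprod (t : Box μ ≃ Fin μ.card) (d : ℕ) (v : Fin μ.card → Fin d → K) :
    placeInBoxes K t d (PiTensorProduct.tprod K v) = PiTensorProduct.tprod K fun c => v (t c) := by
  simp [placeInBoxes]

theorem placeInBoxes_tensorRep (t : Box μ ≃ Fin μ.card) (d : ℕ)
    (g : Matrix.GeneralLinearGroup (Fin d) K) (x : ⨂[K] _ : Fin μ.card, (Fin d → K)) :
    placeInBoxes K t d (tensorRep _ (natRep K d) g x) =
      tensorRep _ (natRep K d) g (placeInBoxes K t d x) := by
  have h : placeInBoxes K t d ∘ₗ tensorRep _ (natRep K d) g =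
      tensorRep _ (natRep K d) g ∘ₗ placeInBoxes K t d := by
    refine PiTensorProduct.ext (MultilinearMap.ext fun v => ?_)
    simp [tensorRep, placeInBoxes_tprod]
  exact LinearMap.congr_fun h x

/-- The homomorphism `G_⊗(S^μ) → ∇^μ(E)`. -/
theorem exists_intertwiningMap [CharP K 2] (d : ℕ) :
    ∃ φ : Representation.IntertwiningMap
        (inverseSchur d (specht K μ).toRepresentation) (dualWeyl K μ d).toRepresentation,
      ∀ s : Box μ → Fin d, φ (tableauClass K s) = weylPolytabloid K s := by
  obtain ⟨Φ, hΦ⟩ := (isGarnir_weylPolytabloid (μ := μ) (K := K) d).exists_lift (K := K)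
  have hΦs : ∀ s : Box μ → Fin d, Φ (tableauClass K s) = weylPolytabloid K s := by
    intro s
    rw [tableauClass, hΦ]
    congr 1
    funext c
    simp
  set t₀ := someTableau μ
  -- Equivariance: with the Specht factor fixed, `Φ` is the column antisymmetriser after placing
  -- factors into boxes, and both commute with the group.
  have hx : ∀ x, (Φ (pureClass x (spechtPolytabloid K t₀ t₀.injective)) :
      RowTabloids K (Fin d → K) μ) = colAntisymmetriser K (Fin d → K) μ (placeInBoxes K t₀ d x) := by
    have h : (dualWeyl K μ d).toSubmodule.subtype ∘ₗ Φ ∘ₗ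
        pureClass.flip (spechtPolytabloid K t₀ t₀.injective) =
        colAntisymmetriser K (Fin d → K) μ ∘ₗ placeInBoxes K t₀ d := by
      refine (wordBasis K _ d).ext fun w => ?_
      rw [LinearMap.comp_apply, LinearMap.comp_apply, LinearMap.flip_apply, hΦ,
        LinearMap.comp_apply, wordBasis_apply, placeInBoxes_tprod]
      rfl
    exact fun x => LinearMap.congr_fun h x
  refine ⟨⟨Φ, fun g => LinearMap.ext_on (span_tableauClass d) ?_⟩, hΦs⟩
  rintro _ ⟨s, rfl⟩
  refine Subtype.ext ?_
  have h₁ := hx (tensorRep _ (natRep K d) g (wordBasis K _ d (s ∘ t₀.symm)))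
  rw [placeInBoxes_tensorRep, ← rowTabloidRep_colAntisymmetriser, ← hx] at h₁
  exact h₁

theorem surjective_of_apply_tableauClass {d : ℕ}
    {φ : Representation.IntertwiningMap
      (inverseSchur d (specht K μ).toRepresentation) (dualWeyl K μ d).toRepresentation}
    (hφ : ∀ s : Box μ → Fin d, φ (tableauClass K s) = weylPolytabloid K s) :
    Function.Surjective φ := by
  change Function.Surjective φ.toLinearMap
  rw [← LinearMap.range_eq_top, ← top_le_iff, ← Submodule.map_le_map_iff_of_injective
    (dualWeyl K μ d).toSubmodule.injective_subtype, Submodule.map_subtype_top]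
  refine Submodule.span_le.2 ?_
  rintro _ ⟨s, rfl⟩
  exact ⟨weylPolytabloid K s, ⟨tableauClass K s, hφ s⟩, rfl⟩

/-- The homomorphism is bijective if all tableaux with a repeated entry in a column vanish. -/
theorem bijective_of_apply_tableauClass [CharP K 2] {d : ℕ}
    {φ : Representation.IntertwiningMap
      (inverseSchur d (specht K μ).toRepresentation) (dualWeyl K μ d).toRepresentation}
    (hφ : ∀ s : Box μ → Fin d, φ (tableauClass K s) = weylPolytabloid K s)
    (h : ∀ s : Box μ → Fin d, ¬ ColDistinct s → tableauClass K s = 0) :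
    Function.Bijective φ := by
  refine ⟨?_, surjective_of_apply_tableauClass hφ⟩
  have hspan : Submodule.span K (Set.range fun t : {t : Box μ → Fin d // Semistandard t} =>
      tableauClass K t.1) = ⊤ := by
    rw [← top_le_iff, ← span_tableauClass, Submodule.span_le]
    rintro _ ⟨s, rfl⟩
    refine Submodule.span_le.2 ?_ ((isGarnir_tableauClass (K := K) d).mem_span (K := K) s)
    rintro _ ⟨σ, h₁, h₂, rfl⟩
    by_cases h₃ : ColDistinct (s ∘ σ)
    · exact Submodule.subset_span ⟨⟨s ∘ σ, h₁, h₂, h₃⟩, rfl⟩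
    · rw [h _ h₃]
      exact Submodule.zero_mem _
  have hli := linearIndependent_polytabloid (μ := μ) (Pi.basisFun K (Fin d))
  let f : SpechtImage K μ d →ₗ[K] RowTabloids K (Fin d → K) μ :=
    (dualWeyl K μ d).toSubmodule.subtype ∘ₗ φ.toLinearMap
  have hf : ∀ s : Box μ → Fin d,
      f (tableauClass K s) = polytabloid (Pi.basisFun K (Fin d)) s :=
    fun s => congrArg Subtype.val (hφ s)
  have hinj : Function.Injective f := by
    rw [← LinearMap.ker_eq_bot, LinearMap.ker_eq_bot']
    intro m hm
    have hmem : m ∈ Submodule.span K (Set.range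
        fun t : {t : Box μ → Fin d // Semistandard t} => tableauClass K t.1) :=
      hspan ▸ Submodule.mem_top
    obtain ⟨a, rfl⟩ := (Finsupp.mem_span_range_iff_exists_finsupp).1 hmem
    rw [map_finsuppSum] at hm
    simp only [map_smul, hf] at hm
    have ha : a = 0 := linearIndependent_iff.1 hli a hm
    rw [ha, Finsupp.sum_zero_index]
  exact fun x y hxy => hinj (congrArg Subtype.val hxy)

end Surjection

/-! ### Vanishing on repeated column entries. -/

section Alternation

variable {μ : YoungDiagram} {K : Type*} [Field K] {B : Type*} {M : Type*} [AddCommGroup M]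

/-- `F` vanishes on tableaux with a repeated entry in column `j`. -/
def AlternatesOn (F : (Box μ → B) → M) (j : ℕ) : Prop :=
  ∀ (t : Box μ → B) (x y : Box μ), x.1.2 = j → y.1.2 = j → x ≠ y → t x = t y → F t = 0

-- Take `S = {x, y}` and `T` all of column `j + 1`. A surviving `P` contains both or neither of `x`,
-- `y`: both means `P = S`, the term `F t`; neither puts the equal entries into column `j + 1`,
-- where `F` vanishes.
variable (K) in
theorem IsGarnir.alternatesOn_of_succ [CharP K 2] [Module K M] {F : (Box μ → B) → M}
    (hF : IsGarnir F) {j : ℕ} (hj : AlternatesOn F (j + 1))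
    (hlen : μ.colLen j ≤ μ.colLen (j + 1) + 1) : AlternatesOn F j := by
  intro t x y hx hy hxy ht
  set S : Finset (Box μ) := {x, y} with hSdef
  set T := colFinset μ (j + 1)
  have hxS : x ∈ S := by simp [hSdef]
  have hyS : y ∈ S := by simp [hSdef]
  have hS : S ⊆ colFinset μ j := by
    intro b hb
    rw [hSdef, mem_insert, mem_singleton] at hb
    rw [mem_colFinset]
    rcases hb with rfl | rfl
    · exact hx
    · exact hy
  have hScard : S.card = 2 := card_pair hxy
  have h := hF.sum_filter_eq_zero K t (Nat.lt_succ_self j) hS (subset_refl T)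
    (by rw [hScard, card_colFinset]; omega) (mem_union_left _ hxS) (mem_union_left _ hyS) ht
  have hmem : S ∈ (S ∪ T).powersetCard S.card := mem_powersetCard.2 ⟨subset_union_left, rfl⟩
  rw [sum_eq_single S, hF.eq_of_isBlockPerm (σ' := 1) _ hS (subset_refl T)
    (isBlockPerm_blockPerm subset_union_left hmem) ⟨fun _ _ => rfl, fun _ => Iff.rfl⟩] at h
  · exact h
  · intro P hP hne
    rw [mem_filter] at hP
    have hσ := isBlockPerm_blockPerm subset_union_left hP.1
    have hxP : x ∉ P := by
      intro hxP
      refine hne (eq_of_subset_of_card_le ?_ (mem_powersetCard.1 hP.1).2.le).symm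
      intro b hb
      rw [hSdef, mem_insert, mem_singleton] at hb
      rcases hb with rfl | rfl
      · exact hxP
      · exact hP.2.1 hxP
    have hyP : y ∉ P := fun hyP => hxP (hP.2.2 hyP)
    refine hj _ ((blockPerm S (S ∪ T) P).symm x) ((blockPerm S (S ∪ T) P).symm y) ?_ ?_
      (fun he => hxy ((blockPerm S (S ∪ T) P).symm.injective he)) ?_
    · rw [hσ.symm_col hS (subset_refl T), if_neg hxP, if_pos (mem_union_left _ hxS)]
    · rw [hσ.symm_col hS (subset_refl T), if_neg hyP, if_pos (mem_union_left _ hyS)]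
    · simpa using ht
  · intro hS'
    exact absurd (mem_filter.2 ⟨hmem, iff_of_true hxS hyS⟩) hS'

-- Take one box of column `j` against `{x, y}`: three boxes exceed the length two, and the only
-- singleton `P` not separating `x` from `y` is `S` itself, so the relation reads `F t = 0`.
variable (K) in
theorem IsGarnir.alternatesOn_of_colLen_eq_two [CharP K 2] [Module K M] {F : (Box μ → B) → M}
    (hF : IsGarnir F) {j : ℕ} (hlen : μ.colLen j = 2) : AlternatesOn F (j + 1) := by
  intro t x y hx hy hxy ht
  set c : Box μ := mkBox (i := 0) (j := j) (by omega) with hc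
  set S : Finset (Box μ) := {c}
  set T : Finset (Box μ) := {x, y} with hTdef
  have hxT : x ∈ T := by simp [hTdef]
  have hyT : y ∈ T := by simp [hTdef]
  have hS : S ⊆ colFinset μ j := by
    rw [singleton_subset_iff, mem_colFinset]
    rfl
  have hT : T ⊆ colFinset μ (j + 1) := by
    intro b hb
    rw [hTdef, mem_insert, mem_singleton] at hb
    rw [mem_colFinset]
    rcases hb with rfl | rfl
    · exact hx
    · exact hy
  have hTcard : T.card = 2 := card_pair hxy
  have hScard : S.card = 1 := card_singleton c
  have h := hF.sum_filter_eq_zero K t (Nat.lt_succ_self j) hS hT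
    (by rw [hScard, hTcard, hlen]; omega) (mem_union_right _ hxT) (mem_union_right _ hyT) ht
  have hdis : ∀ b ∈ T, b ∉ S := fun b hb hb' => (Nat.lt_succ_self j).ne
    ((mem_colFinset.1 (hS hb')).symm.trans (mem_colFinset.1 (hT hb)))
  have hmem : S ∈ (S ∪ T).powersetCard S.card := mem_powersetCard.2 ⟨subset_union_left, rfl⟩
  rw [sum_eq_single S, hF.eq_of_isBlockPerm (σ' := 1) _ hS hT
    (isBlockPerm_blockPerm subset_union_left hmem) ⟨fun _ _ => rfl, fun _ => Iff.rfl⟩] at h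
  · exact h
  · intro P hP hne
    exfalso
    rw [mem_filter, mem_powersetCard, hScard, card_eq_one] at hP
    obtain ⟨⟨hPX, p, rfl⟩, hiff⟩ := hP
    rw [mem_singleton, mem_singleton] at hiff
    rcases mem_union.1 (singleton_subset_iff.1 hPX) with hp | hp
    · rw [mem_singleton.1 hp] at hne
      exact hne rfl
    · rw [hTdef, mem_insert, mem_singleton] at hp
      rcases hp with rfl | rfl
      · exact hxy (hiff.1 rfl).symm
      · exact hxy (hiff.2 rfl)
  · intro hS'
    exact absurd (mem_filter.2 ⟨hmem, iff_of_false (hdis x hxT) (hdis y hyT)⟩) hS'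

variable (K) in
theorem IsGarnir.alternatesOn_of_le [CharP K 2] [Module K M] {F : (Box μ → B) → M}
    (hF : IsGarnir F) {J : ℕ} (hJ : AlternatesOn F J)
    (hlen : ∀ j < J, μ.colLen j ≤ μ.colLen (j + 1) + 1) {j : ℕ} (hj : j ≤ J) :
    AlternatesOn F j :=
  Nat.decreasingInduction' (P := AlternatesOn F)
    (fun k hk _ h => hF.alternatesOn_of_succ K h (hlen k hk)) hj hJ

theorem alternatesOn_of_rowLen_le (F : (Box μ → B) → M) {j : ℕ} (hj : μ.rowLen 0 ≤ j) :
    AlternatesOn F j := by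
  intro t x y hx
  have h₁ := box_lt_rowLen x
  have h₂ := μ.rowLen_anti 0 x.1.1 (Nat.zero_le _)
  omega

end Alternation

/-! ### Translating (∗) into column lengths. -/

section Partitions

variable {μ : YoungDiagram}

theorem lt_rowLen_iff_lt_colLen {i j : ℕ} : j < μ.rowLen i ↔ i < μ.colLen j :=
  YoungDiagram.mem_iff_lt_rowLen.symm.trans YoungDiagram.mem_iff_lt_colLen

theorem nodup_map_range_iff {f : ℕ → ℕ} (hf : Antitone f) {n : ℕ} :
    ((List.range n).map f).Nodup ↔ ∀ i, i + 1 < n → f (i + 1) < f i := by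
  constructor
  · intro h i hi
    refine (hf (Nat.le_succ i)).lt_of_ne fun he => ?_
    have := List.inj_on_of_nodup_map h (List.mem_range.2 hi)
      (List.mem_range.2 (Nat.lt_of_succ_lt hi)) he
    omega
  · intro h
    refine List.Nodup.map_on (fun i hi i' hi' he => ?_) List.nodup_range
    rw [List.mem_range] at hi hi'
    rcases lt_trichotomy i i' with hlt | heq | hlt
    · have h₁ := h i (by omega)
      have h₂ := hf (Nat.succ_le_of_lt hlt)
      simp only [Nat.succ_eq_add_one] at h₂
      omega
    · exact heq
    · have h₁ := h i' (by omega)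
      have h₂ := hf (Nat.succ_le_of_lt hlt)
      simp only [Nat.succ_eq_add_one] at h₂
      omega

theorem twoRegular_rowLens_iff :
    TwoRegular μ.rowLens ↔ ∀ i, 0 < μ.rowLen (i + 1) → μ.rowLen (i + 1) < μ.rowLen i := by
  rw [TwoRegular, YoungDiagram.rowLens, nodup_map_range_iff fun i i' h => μ.rowLen_anti i i' h]
  simp only [lt_rowLen_iff_lt_colLen]

theorem twoRegular_rowLens_tail_iff :
    TwoRegular μ.rowLens.tail ↔
      ∀ i, 1 ≤ i → 0 < μ.rowLen (i + 1) → μ.rowLen (i + 1) < μ.rowLen i := by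
  have h : μ.rowLens.tail = (List.range (μ.colLen 0 - 1)).map fun i => μ.rowLen (i + 1) := by
    rw [YoungDiagram.rowLens]
    cases μ.colLen 0 with
    | zero => rfl
    | succ n => simp [List.range_succ_eq_map, Function.comp_def]
  rw [TwoRegular, h, nodup_map_range_iff fun i i' h => μ.rowLen_anti _ _ (by omega)]
  simp only [lt_rowLen_iff_lt_colLen]
  constructor
  · intro h i hi hlt
    obtain ⟨k, rfl⟩ := Nat.exists_eq_add_of_le' hi
    exact h k (by omega)
  · intro h i hi
    exact h (i + 1) (by omega) (by omega)

/-- A drop of two or more from column `j` to column `j + 1` would give two consecutive rows of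
length exactly `j + 1`. -/
theorem colLen_le_of_rowLen_lt {i₀ j : ℕ}
    (h : ∀ i, i₀ ≤ i → 0 < μ.rowLen (i + 1) → μ.rowLen (i + 1) < μ.rowLen i)
    (hj : i₀ ≤ μ.colLen (j + 1)) : μ.colLen j ≤ μ.colLen (j + 1) + 1 := by
  by_contra hlt
  have h₁ : j < μ.rowLen (μ.colLen (j + 1) + 1) := lt_rowLen_iff_lt_colLen.2 (by omega)
  have h₂ : ¬ j + 1 < μ.rowLen (μ.colLen (j + 1)) := fun hc =>
    lt_irrefl _ (lt_rowLen_iff_lt_colLen.1 hc)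
  have := h _ hj (by omega)
  omega

theorem IsGarnir.alternatesOn_of_isTwoRegularOrNearly (K : Type*) [Field K] [CharP K 2]
    {B M : Type*} [AddCommGroup M] [Module K M] {F : (Box μ → B) → M} (hF : IsGarnir F)
    (hμ : IsTwoRegularOrNearly μ) (j : ℕ) : AlternatesOn F j := by
  rcases le_total (μ.rowLen 0) j with hj | hj
  · exact alternatesOn_of_rowLen_le F hj
  rcases hμ with h | ⟨h₁, h₂, h₃⟩
  · rw [twoRegular_rowLens_iff] at h
    exact hF.alternatesOn_of_le K (alternatesOn_of_rowLen_le F le_rfl)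
      (fun k _ => colLen_le_of_rowLen_lt (i₀ := 0) (fun i _ => h i) (Nat.zero_le _)) hj
  · rw [twoRegular_rowLens_tail_iff] at h₃
    -- The last two columns, `m` and `m + 1`, both have length two, and the propagation starts from
    -- `m + 1`.
    obtain ⟨m, hm⟩ : ∃ m, μ.rowLen 1 = m + 2 := ⟨μ.rowLen 1 - 2, by omega⟩
    rcases hj.lt_or_eq with hj | hj
    · have hcol : μ.colLen m = 2 := by
        have e₁ : 1 < μ.colLen m := lt_rowLen_iff_lt_colLen.1 (by omega)
        have e₂ : ¬ 2 < μ.colLen m := fun hc => by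
          have := lt_rowLen_iff_lt_colLen.2 hc
          omega
        omega
      refine hF.alternatesOn_of_le K (J := m + 1) (hF.alternatesOn_of_colLen_eq_two K hcol)
        (fun k hk => colLen_le_of_rowLen_lt (i₀ := 1) h₃ ?_) (by omega)
      have : 1 < μ.colLen (k + 1) := lt_rowLen_iff_lt_colLen.1 (by omega)
      omega
    · exact alternatesOn_of_rowLen_le F hj.ge

/-- Three consecutive rows which witness that a partition is neither `2`-regular nor nearly so. -/
theorem exists_rows_of_not_isTwoRegularOrNearly (h : ¬ IsTwoRegularOrNearly μ) :
    ∃ p, p + 1 < μ.colLen 0 ∧ (p = 0 ∨ p + 3 ≤ μ.colLen 0) ∧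
      ∀ j j', j < j' → μ.colLen j = p + 2 → μ.colLen j' ≤ p := by
  by_cases hex : ∃ i, 1 ≤ i ∧ 0 < μ.rowLen (i + 1) ∧ μ.rowLen i ≤ μ.rowLen (i + 1)
  · obtain ⟨i, hi, hpos, hle⟩ := hex
    obtain ⟨p, rfl⟩ := Nat.exists_eq_add_of_le' hi
    have h₁ := lt_rowLen_iff_lt_colLen.1 hpos
    -- Rows `p + 1` and `p + 2` have equal length, so no column has length exactly `p + 2`.
    refine ⟨p, by omega, Or.inr (by omega), fun j j' _ hj => ?_⟩
    have h₂ : j < μ.rowLen (p + 1) := lt_rowLen_iff_lt_colLen.2 (by omega)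
    have h₃ := lt_rowLen_iff_lt_colLen.1 (h₂.trans_le hle)
    omega
  · push Not at hex
    rw [IsTwoRegularOrNearly, not_or, twoRegular_rowLens_iff, twoRegular_rowLens_tail_iff] at h
    obtain ⟨h₁, h₂⟩ := h
    push Not at h₁
    obtain ⟨i, hpos, hle⟩ := h₁
    obtain rfl : i = 0 := by
      by_contra hi
      exact absurd (hex i (by omega) hpos) (not_lt.2 hle)
    have hanti := μ.rowLen_anti 0 1 (by omega)
    rw [zero_add] at hpos hle
    have h₃ : ¬ μ.rowLen 2 + 2 ≤ μ.rowLen 1 := fun hc => h₂ ⟨by omega, hc, hex⟩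
    -- Only the first two rows agree, and at most one column has length two; any column after it is
    -- empty.
    refine ⟨0, lt_rowLen_iff_lt_colLen.1 hpos, Or.inl rfl, fun j j' hj hcol => ?_⟩
    have h₄ : ¬ j < μ.rowLen 2 := fun hc => by
      have := lt_rowLen_iff_lt_colLen.1 hc
      omega
    by_contra hj'
    have := lt_rowLen_iff_lt_colLen.2 (not_le.1 hj')
    omega

end Partitions

/-! ### Parity of binomial coefficients. -/

section Counting

/-- The number of subsets with prescribed content is a product of binomial coefficients over the
values. Splitting off the factor of `v` suffices for parity. -/
theorem even_card_powerset_filter {α β : Type*} [DecidableEq α] [DecidableEq β] [Fintype β]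
    (X : Finset α) (t : α → β) (q : β → ℕ) (v : β)
    (h : Even ((X.filter fun x => t x = v).card.choose (q v))) :
    Even (X.powerset.filter fun P => ∀ w, (P.filter fun x => t x = w).card = q w).card := by
  set G := X.powerset.filter fun P => ∀ w, (P.filter fun x => t x = w).card = q w
  have hcard : G.card = (((X.filter fun x => t x = v).powersetCard (q v)) ×ˢ
      (G.image fun P => P.filter fun x => t x ≠ v)).card := by
    refine card_nbij' (fun P => (P.filter fun x => t x = v, P.filter fun x => t x ≠ v))
      (fun r => r.1 ∪ r.2) ?_ ?_ ?_ ?_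
    · intro P hP
      have hP' := mem_filter.1 hP
      refine mem_product.2 ⟨mem_powersetCard.2 ⟨?_, hP'.2 v⟩, mem_image_of_mem _ hP⟩
      exact filter_subset_filter _ (mem_powerset.1 hP'.1)
    · rintro ⟨D, R⟩ hr
      obtain ⟨hD, hR⟩ := mem_product.1 hr
      obtain ⟨P, hP, hPR⟩ := mem_image.1 hR
      obtain ⟨hDX, hDq⟩ := mem_powersetCard.1 hD
      have hP' := mem_filter.1 hP
      simp only at hPR hDX hDq
      subst hPR
      refine mem_filter.2 ⟨mem_powerset.2 (union_subset (hDX.trans (filter_subset _ _))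
        ((filter_subset _ _).trans (mem_powerset.1 hP'.1))), fun w => ?_⟩
      by_cases hw : w = v
      · subst hw
        rw [← hDq]
        congr 1
        ext x
        simp only [mem_filter, mem_union]
        constructor
        · rintro ⟨h₁ | h₁, h₂⟩
          · exact h₁
          · exact absurd h₂ h₁.2
        · intro h₁
          exact ⟨Or.inl h₁, (mem_filter.1 (hDX h₁)).2⟩
      · rw [← hP'.2 w]
        congr 1
        ext x
        simp only [mem_filter, mem_union]
        constructor
        · rintro ⟨h₁ | h₁, h₂⟩
          · exact absurd (h₂.symm.trans (mem_filter.1 (hDX h₁)).2) hw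
          · exact ⟨h₁.1, h₂⟩
        · rintro ⟨h₁, h₂⟩
          exact ⟨Or.inr ⟨h₁, fun hv => hw (h₂.symm.trans hv)⟩, h₂⟩
    · intro P _
      exact filter_union_filter_not_eq _ P
    · rintro ⟨D, R⟩ hr
      obtain ⟨hD, hR⟩ := mem_product.1 hr
      obtain ⟨P, hP, hPR⟩ := mem_image.1 hR
      obtain ⟨hDX, hDq⟩ := mem_powersetCard.1 hD
      simp only at hPR hDX
      subst hPR
      have hDv : ∀ x ∈ D, t x = v := fun x hx => (mem_filter.1 (hDX hx)).2
      refine Prod.ext ?_ ?_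
      · ext x
        simp only [mem_filter, mem_union]
        constructor
        · rintro ⟨h₁ | h₁, h₂⟩
          · exact h₁
          · exact absurd h₂ h₁.2
        · intro h₁
          exact ⟨Or.inl h₁, hDv x h₁⟩
      · ext x
        simp only [mem_filter, mem_union]
        constructor
        · rintro ⟨h₁ | h₁, h₂⟩
          · exact absurd (hDv x h₁) h₂
          · exact h₁
        · intro h₁
          exact ⟨Or.inr h₁, h₁.2⟩
  rw [hcard, card_product, card_powersetCard]
  exact h.mul_right _

/-- The values that occur are `2`, `4`, `6`, `10` and `20`. The case `k = 2` must be restricted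
because `3` choose `1` is odd. -/
theorem even_choose_of_le_three {a b k k' : ℕ} (hk : k ≤ 3) (hkk : k' ≤ k)
    (h₂ : k = 2 → k' = 0) (ha : a ≤ k) (hb : b ≤ k') (hab : k < a + b) :
    Even ((a + b).choose a) := by
  have ha3 : a ≤ 3 := ha.trans hk
  have hb3 : b ≤ 3 := hb.trans (hkk.trans hk)
  interval_cases a <;> interval_cases b <;> first | decide | omega

end Counting

/-! ### Indicators of column contents as Garnir functions. -/

section ColumnIndicator

variable {μ : YoungDiagram} {K : Type*} [Field K] {d : ℕ}

/-- The number of entries `v` in column `j`. -/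
def colContent (t : Box μ → Fin d) (j : ℕ) (v : Fin d) : ℕ :=
  (univ.filter fun c : Box μ => c.1.2 = j ∧ t c = v).card

theorem colContent_comp_eq (t : Box μ → Fin d) (σ : Equiv.Perm (Box μ)) (j : ℕ) (v : Fin d) :
    colContent (t ∘ σ) j v =
      (univ.filter fun c : Box μ => (σ.symm c).1.2 = j ∧ t c = v).card := by
  refine card_nbij' (fun b => σ b) (fun b => σ.symm b) ?_ ?_ ?_ ?_
  · intro b hb
    simpa using hb
  · intro b hb
    simpa using hb
  · intro b _
    simp
  · intro b _
    simp

theorem colContent_comp (t : Box μ → Fin d) {τ : Equiv.Perm (Box μ)} (hτ : IsColPreserving τ) :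
    colContent (t ∘ τ) = colContent t := by
  funext j v
  rw [colContent_comp_eq, colContent]
  congr 1
  ext c
  rw [mem_filter, mem_filter, show (τ.symm c).1.2 = c.1.2 from isColPreserving_inv hτ c]

theorem colContent_blockPerm (t : Box μ → Fin d) {j j' : ℕ} {S T P : Finset (Box μ)}
    {σ : Equiv.Perm (Box μ)} (hσ : IsBlockPerm S (S ∪ T) P σ) (hS : S ⊆ colFinset μ j)
    (hT : T ⊆ colFinset μ j') (hP : P ⊆ S ∪ T) (k : ℕ) (v : Fin d) :
    colContent (t ∘ σ) k v =
      (univ.filter fun c : Box μ => c ∉ S ∪ T ∧ c.1.2 = k ∧ t c = v).card +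
      ((if j = k then (P.filter fun c => t c = v).card else 0) +
        if j' = k then (((S ∪ T) \ P).filter fun c => t c = v).card else 0) := by
  have h₁ : ∀ (Q : Finset (Box μ)) (i : ℕ), (if i = k then (Q.filter fun c => t c = v).card
      else 0) = (Q.filter fun c => i = k ∧ t c = v).card := by
    intro Q i
    split_ifs with h
    · simp [h]
    · simp [h]
  rw [colContent_comp_eq, h₁, h₁, ← card_union_of_disjoint, ← card_union_of_disjoint]
  · congr 1
    ext c
    have hc := hσ.symm_col hS hT c
    have hPc := @hP c
    simp only [mem_filter, mem_univ, true_and, mem_union, mem_sdiff] at hc hPc ⊢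
    rw [hc]
    by_cases hcP : c ∈ P
    · simp [hcP, hPc hcP]
    · by_cases hcX : c ∈ S ∨ c ∈ T
      · simp [hcP, hcX]
      · simp [hcP, hcX]
  · rw [disjoint_left]
    intro c hc hc'
    have h₂ := (mem_filter.1 hc).2.1
    rcases mem_union.1 hc' with h | h
    · exact h₂ (hP (mem_filter.1 h).1)
    · exact h₂ (mem_sdiff.1 (mem_filter.1 h).1).1
  · rw [disjoint_left]
    intro c hc hc'
    exact (mem_sdiff.1 (mem_filter.1 hc').1).2 (mem_filter.1 hc).1

theorem sum_colContent (t : Box μ → Fin d) (j : ℕ) : ∑ v, colContent t j v = μ.colLen j := by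
  rw [← card_colFinset, card_eq_sum_card_fiberwise (f := t) (t := univ) fun _ _ => by simp]
  refine sum_congr rfl fun v _ => ?_
  rw [colContent]
  congr 1
  ext c
  simp [mem_colFinset]

open scoped Classical in
/-- The indicator function of the column rearrangements of `s` is a Garnir function if certain
binomial coefficients are even. -/
theorem isGarnir_indicator [CharP K 2] (s : Box μ → Fin d)
    (hs : ∀ (v : Fin d) (j j' a b : ℕ), j < j' → a ≤ colContent s j v → b ≤ colContent s j' v →
      colContent s j v < a + b → Even ((a + b).choose a)) :
    IsGarnir fun t : Box μ → Fin d => if colContent t = colContent s then (1 : K) else 0 := by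
  refine ⟨fun t τ hτ => by rw [colContent_comp t hτ], fun t j j' S T hj hS hT hcard => ?_⟩
  rw [sum_boole]
  set X := S ∪ T
  by_cases hex : ∃ Q ∈ X.powersetCard S.card, colContent (t ∘ blockPerm S X Q) = colContent s
  swap
  · push Not at hex
    rw [filter_false_of_mem hex, card_empty, Nat.cast_zero]
  obtain ⟨Q, hQ, hQs⟩ := hex
  have hcont : ∀ P ∈ X.powersetCard S.card, ∀ k v, colContent (t ∘ blockPerm S X P) k v =
      (univ.filter fun c : Box μ => c ∉ X ∧ c.1.2 = k ∧ t c = v).card +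
      ((if j = k then (P.filter fun c => t c = v).card else 0) +
        if j' = k then ((X \ P).filter fun c => t c = v).card else 0) := fun P hP k v =>
    colContent_blockPerm t (isBlockPerm_blockPerm subset_union_left hP) hS hT
      (mem_powersetCard.1 hP).1 k v
  have hsplit : ∀ P ⊆ X, ∀ v, (P.filter fun c => t c = v).card +
      ((X \ P).filter fun c => t c = v).card = (X.filter fun c => t c = v).card := by
    intro P hP v
    rw [← card_union_of_disjoint (disjoint_filter_filter disjoint_sdiff), ← filter_union,
      union_sdiff_of_subset hP]
  set q : Fin d → ℕ := fun v => (Q.filter fun c => t c = v).card with hq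
  -- Once one `Q` contributes, the contributing `P` are exactly the subsets of `X` with the same
  -- content as `Q`.
  have hset : (X.powersetCard S.card).filter (fun P => colContent (t ∘ blockPerm S X P) =
      colContent s) = X.powerset.filter fun P => ∀ w, (P.filter fun x => t x = w).card = q w := by
    ext P
    rw [mem_filter, mem_filter, mem_powerset]
    constructor
    · rintro ⟨hP, hPs⟩
      refine ⟨(mem_powersetCard.1 hP).1, fun w => ?_⟩
      have h := congrFun (congrFun (hPs.trans hQs.symm) j) w
      rw [hcont P hP, hcont Q hQ, if_pos rfl, if_pos rfl, if_neg hj.ne', if_neg hj.ne'] at h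
      simp only [hq]
      omega
    · rintro ⟨hPX, hP⟩
      have hPmem : P ∈ X.powersetCard S.card := by
        refine mem_powersetCard.2 ⟨hPX, ?_⟩
        rw [← (mem_powersetCard.1 hQ).2,
          card_eq_sum_card_fiberwise (s := P) (f := t) (t := univ) fun _ _ => by simp,
          card_eq_sum_card_fiberwise (s := Q) (f := t) (t := univ) fun _ _ => by simp]
        exact sum_congr rfl fun w _ => hP w
      refine ⟨hPmem, ?_⟩
      rw [← hQs]
      funext k v
      have h₁ := hP v
      have h₂ := hsplit P hPX v
      have h₃ := hsplit Q (mem_powersetCard.1 hQ).1 v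
      simp only [hq] at h₁
      rw [hcont P hPmem, hcont Q hQ, h₁]
      have h₄ : ((X \ P).filter fun c => t c = v).card =
          ((X \ Q).filter fun c => t c = v).card := by omega
      rw [h₄]
  rw [hset]
  -- Pigeonhole: `X` has more boxes than column `j`, so some value is more frequent in `X` than in
  -- column `j` of `s`; its binomial factor is even.
  obtain ⟨v, hv⟩ : ∃ v, colContent s j v < (X.filter fun c => t c = v).card := by
    by_contra hcon
    push Not at hcon
    have h₁ := sum_le_sum fun v (_ : v ∈ univ) => hcon v
    rw [sum_colContent, ← card_eq_sum_card_fiberwise (s := X) (f := t) (t := univ)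
      fun _ _ => by simp] at h₁
    have hdis : Disjoint S T := by
      rw [disjoint_left]
      intro b hb hb'
      exact hj.ne ((mem_colFinset.1 (hS hb)).symm.trans (mem_colFinset.1 (hT hb')))
    rw [card_union_of_disjoint hdis] at h₁
    omega
  have h₁ := hsplit Q (mem_powersetCard.1 hQ).1 v
  have h₂ := hcont Q hQ j v
  have h₃ := hcont Q hQ j' v
  rw [hQs, if_pos rfl, if_neg hj.ne'] at h₂
  rw [hQs, if_pos rfl, if_neg hj.ne] at h₃
  have heven := even_card_powerset_filter X t q v (by
    rw [← h₁]
    exact hs v j j' _ _ hj (by omega) (by omega) (by omega))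
  obtain ⟨k, hk⟩ := heven
  have hcast := congrArg (Nat.cast : ℕ → K) hk
  rw [Nat.cast_add, CharTwo.add_self_eq_zero] at hcast
  convert hcast

end ColumnIndicator

/-! ### A nonzero kernel element when (∗) fails. -/

section NotInjective

variable {μ : YoungDiagram} {K : Type*} [Field K]

/-- The entry in row `i` of a tableau whose rows are constant, with entry `0` in the rows `p`,
`p + 1`, `p + 2` and distinct nonzero entries in the other rows. -/
def mergedRowEntry (p i : ℕ) : ℕ := if i < p then i + 1 else if i ≤ p + 2 then 0 else i - 2

theorem mergedRowEntry_eq_zero {p i : ℕ} : mergedRowEntry p i = 0 ↔ p ≤ i ∧ i ≤ p + 2 := by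
  unfold mergedRowEntry
  constructor
  · intro h
    split_ifs at h <;> omega
  · intro h
    rw [if_neg (by omega), if_pos h.2]

theorem mergedRowEntry_inj {p i i' : ℕ} (h : mergedRowEntry p i = mergedRowEntry p i')
    (h0 : mergedRowEntry p i ≠ 0) : i = i' := by
  unfold mergedRowEntry at h h0
  split_ifs at h h0 <;> omega

theorem colLen_zero_le_card : μ.colLen 0 ≤ μ.card := by
  rw [← card_colFinset]
  refine (card_le_univ _).trans_eq ?_
  exact Fintype.card_coe μ.cells

/-- Merging three rows saves two entries, so `n - 2` entries suffice. If `p = 0` and there are only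
two rows, the single entry `0` is used. -/
theorem mergedRowEntry_lt {p d : ℕ} (hd : 0 < d) (hcard : μ.card ≤ d + 2)
    (hp : p = 0 ∨ p + 3 ≤ μ.colLen 0) (c : Box μ) : mergedRowEntry p c.1.1 < d := by
  have h₁ := (box_lt_colLen c).trans_le (μ.colLen_anti _ _ (Nat.zero_le _))
  have h₂ := colLen_zero_le_card (μ := μ)
  unfold mergedRowEntry
  split_ifs <;> omega

theorem even_choose_mergedRow {p d : ℕ} (hd : ∀ c : Box μ, mergedRowEntry p c.1.1 < d)
    (hp : ∀ j j', j < j' → μ.colLen j = p + 2 → μ.colLen j' ≤ p)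
    (v : Fin d) (j j' a b : ℕ) (hj : j < j')
    (ha : a ≤ colContent (fun c : Box μ => (⟨mergedRowEntry p c.1.1, hd c⟩ : Fin d)) j v)
    (hb : b ≤ colContent (fun c : Box μ => (⟨mergedRowEntry p c.1.1, hd c⟩ : Fin d)) j' v)
    (hab : colContent (fun c : Box μ => (⟨mergedRowEntry p c.1.1, hd c⟩ : Fin d)) j v < a + b) :
    Even ((a + b).choose a) := by
  have hN : ∀ j, colContent (fun c : Box μ => (⟨mergedRowEntry p c.1.1, hd c⟩ : Fin d)) j v =
      ((range (μ.colLen j)).filter fun i => mergedRowEntry p i = v).card := by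
    intro j
    rw [← card_filter_colFinset j (fun i => mergedRowEntry p i = v), colContent]
    congr 1
    ext c
    simp [mem_colFinset, Fin.ext_iff]
  rw [hN] at ha hb hab
  have hanti := μ.colLen_anti j j' hj.le
  have hmono : ((range (μ.colLen j')).filter fun i => mergedRowEntry p i = v).card ≤
      ((range (μ.colLen j)).filter fun i => mergedRowEntry p i = v).card :=
    card_le_card (filter_subset_filter _ (range_subset_range.2 hanti))
  by_cases hv : (v : ℕ) = 0
  -- A column contains at most three entries `0`, and exactly two only if its length is `p + 2`; by
  -- the choice of `p`, later columns then contain none.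
  · have h0 : ∀ n, ((range n).filter fun i => mergedRowEntry p i = v).card =
        min n (p + 3) - p := by
      intro n
      have : (range n).filter (fun i => mergedRowEntry p i = v) = Ico p (min n (p + 3)) := by
        ext i
        rw [mem_filter, hv, mergedRowEntry_eq_zero, mem_range, mem_Ico]
        omega
      rw [this, Nat.card_Ico]
    rw [h0] at ha hb hab
    have := hp j j' hj
    exact even_choose_of_le_three (k := min (μ.colLen j) (p + 3) - p)
      (k' := min (μ.colLen j') (p + 3) - p) (by omega) (by omega) (by omega) ha hb hab
  · have h1 : ((range (μ.colLen j)).filter fun i => mergedRowEntry p i = v).card ≤ 1 := by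
      rw [card_le_one]
      intro i hi i' hi'
      rw [mem_filter] at hi hi'
      exact mergedRowEntry_inj (hi.2.trans hi'.2.symm) (by omega)
    exact even_choose_of_le_three (by omega) hmono (by omega) ha hb hab

theorem not_injective_of_apply_tableauClass [CharP K 2] {d : ℕ} (hd : 0 < d)
    (hcard : μ.card ≤ d + 2) (hμ : ¬ IsTwoRegularOrNearly μ)
    {φ : Representation.IntertwiningMap
      (inverseSchur d (specht K μ).toRepresentation) (dualWeyl K μ d).toRepresentation}
    (hφ : ∀ s : Box μ → Fin d, φ (tableauClass K s) = weylPolytabloid K s) :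
    ¬ Function.Injective φ := by
  classical
  intro hinj
  obtain ⟨p, h₁, h₂, h₃⟩ := exists_rows_of_not_isTwoRegularOrNearly hμ
  have hlt := mergedRowEntry_lt (μ := μ) hd hcard h₂
  set s : Box μ → Fin d := fun c => ⟨mergedRowEntry p c.1.1, hlt c⟩ with hs
  obtain ⟨Φ, hΦ⟩ := (isGarnir_indicator (K := K) s
    fun v j j' a b => even_choose_mergedRow hlt h₃ v j j' a b).exists_lift (K := K)
  -- Rows `p` and `p + 1` both meet the first column in the entry `0`, so the class of `s` lies in
  -- the kernel, while `Φ` takes the value `1` on it.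
  have hzero : polytabloid (Pi.basisFun K (Fin d)) s = 0 := by
    refine polytabloid_eq_zero _ s (c := mkBox (i := p) (j := 0) (by omega))
      (c' := mkBox (i := p + 1) (j := 0) h₁) (fun h => ?_) rfl ?_
    · have := congrArg (fun c : Box μ => c.1.1) h
      simp [mkBox] at this
    · refine Fin.ext ?_
      change mergedRowEntry p p = mergedRowEntry p (p + 1)
      rw [mergedRowEntry_eq_zero.2 ⟨le_rfl, by omega⟩,
        mergedRowEntry_eq_zero.2 ⟨by omega, by omega⟩]
  have hclass : tableauClass K s = 0 := by
    refine hinj ?_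
    rw [hφ]
    exact (Subtype.ext hzero).trans (map_zero φ.toLinearMap).symm
  have h := hΦ (s ∘ (someTableau μ).symm) (someTableau μ) (someTableau μ).injective
  change Φ (tableauClass K s) = _ at h
  have hcomp : (s ∘ (someTableau μ).symm) ∘ someTableau μ = s := by
    funext c
    simp
  rw [hclass, map_zero, hcomp, if_pos rfl] at h
  exact zero_ne_one h

end NotInjective

end SchurFunctor

end

theorem mainTheorem2 {K : Type*} [Field K] [CharP K 2] (d : ℕ) (hd : 0 < d)
    (μ : YoungDiagram) (hμ : 0 < μ.card) :
    ∃ φ : Representation.IntertwiningMap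
        (SchurFunctor.inverseSchur d (SchurFunctor.specht K μ).toRepresentation)
        (SchurFunctor.dualWeyl K μ d).toRepresentation,
      Function.Surjective φ ∧
      (SchurFunctor.IsTwoRegularOrNearly μ → Function.Bijective φ) ∧
      (μ.card ≤ d + 2 → ¬ SchurFunctor.IsTwoRegularOrNearly μ → ¬ Function.Bijective φ) := by
  obtain ⟨φ, hφ⟩ := SchurFunctor.exists_intertwiningMap (μ := μ) (K := K) d
  refine ⟨φ, SchurFunctor.surjective_of_apply_tableauClass hφ, fun h => ?_, fun hcard h hb =>
    SchurFunctor.not_injective_of_apply_tableauClass hd hcard h hφ hb.1⟩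
  refine SchurFunctor.bijective_of_apply_tableauClass hφ fun s hs => ?_
  simp only [SchurFunctor.ColDistinct, not_forall] at hs
  obtain ⟨c, c', hcol, hcc, hne⟩ := hs
  exact (SchurFunctor.isGarnir_tableauClass d).alternatesOn_of_isTwoRegularOrNearly K h c'.1.2
    s c c' hcol rfl hne hcc
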